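/- Let $k$ be an infinite field with $\operatorname{char}(k)\neq 2,3$ and let $V$ be a $k$-vector space. For $n\ge 0$ let $\mathcal T^{S^3}_V[n]=V^{\otimes\binom n3}$, the tensor factors being indexed by the triples $1\le i<j<l\le n$, and write $\otimes_{1\le i<j<l\le n}(v_{i,j,l})$ for its simple tensors. Let $\mathcal E^{S^3}_V[n]$ be the subspace spanned by all simple tensors for which there exist $1\le x<y<z<t\le n$ with $v_{x,y,z}=v_{x,y,t}=v_{x,z,t}=v_{y,z,t}$, and put $\Lambda^{S^3}_V[n]=\mathcal T^{S^3}_V[n]/\mathcal E^{S^3}_V[n]$. If $e_1,e_2$ is a basis of a two-dimensional space $V_2$, let $\Lambda^{S^3}_{V_2}[n]^{p,q}\subseteq\Lambda^{S^3}_{V_2}[n]$ be the span of the classes of the simple tensors $\otimes(v_{i,j,l})$ with all $v_{i,j,l}\in\{e_1,e_2\}$, exactly $p$ of them equal to $e_1$ and exactly $q$ of them equal to $e_2$. **Proposition 4.11.** Let $V_2$ be a $k$-vector space of dimension two. Then 1. $\dim_k\Lambda^{S^3}_{V_2}[0]=\dim_k\Lambda^{S^3}_{V_2}[1]=\dim_k\Lambda^{S^3}_{V_2}[2]=1$;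 2. $\dim_k\Lambda^{S^3}_{V_2}[3]=2$; 3. $\dim_k\Lambda^{S^3}_{V_2}[4]=11$; 4. $\dim_k\Lambda^{S^3}_{V_2}[5]=62$; moreover, for every basis $e_1,e_2$ of $V_2$, $\Lambda^{S^3}_{V_2}[5]$ is the internal direct sum of $\Lambda^{S^3}_{V_2}[5]^{6,4}$, $\Lambda^{S^3}_{V_2}[5]^{5,5}$ and $\Lambda^{S^3}_{V_2}[5]^{4,6}$, which have dimensions $15$, $32$ and $15$ respectively; 5. $\dim_k\Lambda^{S^3}_{V_2}[6]=1$; 6. $\dim_k\Lambda^{S^3}_{V_2}[n]=0$ for all $n\ge 7$. -/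

import Mathlib

/-- The index set of triples `i < j < k` in `Fin n` (it has `n.choose 3` elements). -/
abbrev Triple (n : ℕ) : Type :=
  {s : Fin n × Fin n × Fin n // s.1 < s.2.1 ∧ s.2.1 < s.2.2}

/-- The triple `(i, j, k)` with `i < j < k`. -/
def Triple.of {n : ℕ} (i j k : Fin n) (hij : i < j) (hjk : j < k) : Triple n :=
  ⟨(i, j, k), hij, hjk⟩

/-- The tensor power of `V` with one factor for every triple `i < j < k` in `Fin n`. -/
abbrev TensorS3 (k V : Type*) [Field k] [AddCommGroup V] [Module k V] (n : ℕ) : Type _ :=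
  PiTensorProduct k (fun _ : Triple n => V)

/-- The family `v` takes one and the same value on the four triples contained in some
`{x < y < z < t}`. -/
def ConstOnSomeQuadruple {V : Type*} {n : ℕ} (v : Triple n → V) : Prop :=
  ∃ (x y z t : Fin n) (hxy : x < y) (hyz : y < z) (hzt : z < t),
    v (Triple.of x y z hxy hyz) = v (Triple.of x y t hxy (hyz.trans hzt)) ∧
    v (Triple.of x y t hxy (hyz.trans hzt)) = v (Triple.of x z t (hxy.trans hyz) hzt) ∧
    v (Triple.of x z t (hxy.trans hyz) hzt) = v (Triple.of y z t hyz hzt)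

/-- The subspace spanned by the simple tensors that are constant on some quadruple. -/
def ExtRelS3 (k V : Type*) [Field k] [AddCommGroup V] [Module k V] (n : ℕ) :
    Submodule k (TensorS3 k V n) :=
  Submodule.span k
    {w | ∃ v : Triple n → V, ConstOnSomeQuadruple v ∧ w = PiTensorProduct.tprod k v}

/-- The degree `n` component of the graded vector space `Λ^{S³}_V`. -/
abbrev LambdaS3 (k V : Type*) [Field k] [AddCommGroup V] [Module k V] (n : ℕ) : Type _ :=
  TensorS3 k V n ⧸ ExtRelS3 k V n

/-- The weight `(p, q)` piece of `Λ^{S³}_V[n]` for a basis `e = (e 0, e 1)` of `V`: the span of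
the classes of the simple tensors with `p` entries equal to `e 0` and `q` entries equal to `e 1`
(and no other entries). -/
def weightPieceS3 {k V : Type*} [Field k] [AddCommGroup V] [Module k V]
    (e : Module.Basis (Fin 2) k V) (n p q : ℕ) : Submodule k (LambdaS3 k V n) :=
  Submodule.span k
    {w | ∃ c : Triple n → Fin 2,
      (Finset.univ.filter fun s => c s = 0).card = p ∧
      (Finset.univ.filter fun s => c s = 1).card = q ∧
      w = (ExtRelS3 k V n).mkQ (PiTensorProduct.tprod k fun s => e (c s))}

/-! Fix a basis `e`. The classes of basis tensors are indexed by two-colourings of the triples and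
span. Upper and lower bounds for the dimensions come from independent arguments that meet.

Upper bound. A tensor with the value `e 0 + b • e 1` on all four triples of a quadruple and basis
vectors elsewhere is zero in the quotient. It is polynomial in `b`, so over an infinite field each
coefficient vanishes (`quadRelations_colorClass`): for every `j`, the colourings with `j` entries
`true` on the quadruple and fixed values off it sum to zero. Reading a colouring as a binary number,
with triples in colexicographic order, gives a total order, and an integral combination of relations
whose largest term has coefficient `1` or `-1` rewrites that term by smaller ones. Iterating
(`mem_span_of_lower`), the irreducible colourings span. Finite computation leaves 11 of them for
four points and 62 for five. For more points, reduction on a five-element subset induces reduction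
of the whole colouring (`mem_span_lower_of_gather`). On six points only five colourings are standard
on every five-element subset (`extendCodes_six`), and four of these reduce further; on seven points
there are none (`extendCodes_seven`), which kills every larger degree as well.

Lower bound. Choose an integer matrix with one row per triple, colour its columns, and multiply each
entry by the coordinate of the corresponding tensor factor selected by the column colour. The
determinant is multilinear. If the four rows of every quadruple satisfy a linear relation with a
coefficient equal to one, it vanishes whenever the four vectors agree (`Columns.detMap_eq_zero`).
Rows of the simplicial boundary matrix qualify because the boundary of a boundary is zero; rows made
equal within each quadruple also qualify. Such functionals are triangular, with diagonal `1` or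
`-1`, on the standard colourings (`linearIndependent_of_isTriangular`).

The relations are homogeneous in the number of `true` entries (`QuadRelations.ite_trueCount`), so
sorting the resulting basis for five points by this number gives the weight decomposition. -/

set_option maxRecDepth 10000

/-! ### Colourings and quadruple relations -/

/-- The rank of the triple `i < j < l` in the colexicographic order. -/
def tripleRank (i j l : ℕ) : ℕ := i + j.choose 2 + l.choose 3

/-- The ranks of the four triples contained in `{x < y < z < t}`. -/
def quadRanks (x y z t : ℕ) : List ℕ :=
  [tripleRank x y z, tripleRank x y t, tripleRank x z t, tripleRank y z t]

/-- The colouring which is `true` on `s` and `false` on `q \ s`, and agrees with `c` off `q`. -/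
def recolor (q s : Finset ℕ) (c : ℕ → Bool) : ℕ → Bool :=
  fun p => if p ∈ q then decide (p ∈ s) else c p

/-- A function on the colourings of the triples whose sum over all colourings with `j` entries
`true` on a quadruple of `{0, …, n - 1}`, and prescribed off it, vanishes. -/
def QuadRelations {M : Type*} [AddCommMonoid M] (n : ℕ) (φ : (ℕ → Bool) → M) : Prop :=
  ∀ x y z t, x < y → y < z → z < t → t < n → ∀ (j : ℕ) (c : ℕ → Bool),
    ∑ s ∈ (quadRanks x y z t).toFinset.powersetCard j,
      φ (recolor (quadRanks x y z t).toFinset s c) = 0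

/-- The list of all quadruples of triples in `{0, …, n - 1}`. -/
def quadList (n : ℕ) : List (List ℕ) :=
  ((List.range n).sublistsLen 4).map fun l => quadRanks (l.getD 0 0) (l.getD 1 0) (l.getD 2 0)
    (l.getD 3 0)

theorem mem_quadList {n : ℕ} {q : List ℕ} :
    q ∈ quadList n ↔ ∃ x y z t, x < y ∧ y < z ∧ z < t ∧ t < n ∧ q = quadRanks x y z t := by
  simp only [quadList, List.mem_map, List.mem_sublistsLen]
  constructor
  · rintro ⟨l, ⟨hl, hlen⟩, rfl⟩
    have hp : l.Pairwise (· < ·) := List.pairwise_lt_range.sublist hl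
    match l, hlen with
    | [x, y, z, t], _ =>
      have ht : t < n := List.mem_range.1 (hl.subset (by simp))
      simp at hp
      exact ⟨x, y, z, t, by omega, by omega, by omega, ht, rfl⟩
  · rintro ⟨x, y, z, t, h1, h2, h3, h4, rfl⟩
    refine ⟨[x, y, z, t], ⟨?_, rfl⟩, rfl⟩
    have hs : [x, y, z, t].SortedLT := by
      rw [List.sortedLT_iff_pairwise]; simp; omega
    refine List.sublist_of_subperm_of_pairwise (r := (· < ·)) ?_ hs.pairwise List.pairwise_lt_range
    refine List.subperm_of_subset hs.nodup ?_
    intro a ha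
    simp at ha
    rw [List.mem_range]; omega

theorem tripleRank_lt_choose {i j l : ℕ} (hij : i < j) (hjl : j < l) :
    tripleRank i j l < (l + 1).choose 3 := by
  have h1 : (j + 1).choose 2 = j + j.choose 2 := by
    rw [Nat.choose_succ_succ, Nat.choose_one_right]
  have h2 : (j + 1).choose 2 ≤ l.choose 2 := Nat.choose_le_choose 2 hjl
  have h3 : (l + 1).choose 3 = l.choose 2 + l.choose 3 := Nat.choose_succ_succ _ _
  unfold tripleRank
  omega

/-- Uniqueness of the combinatorial number system: triples with top element `l` have ranks in the
interval from `l.choose 3` up to, but excluding, `(l + 1).choose 3`, and likewise for the pair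
below. -/
theorem tripleRank_injective {i j l i' j' l' : ℕ} (hij : i < j) (hjl : j < l) (hij' : i' < j')
    (hjl' : j' < l') (h : tripleRank i j l = tripleRank i' j' l') : i = i' ∧ j = j' ∧ l = l' := by
  have key : ∀ {a b m a' b' m' : ℕ}, a < b → b < m → a' < b' → b' < m' →
      tripleRank a b m = tripleRank a' b' m' → ¬ m < m' := by
    intro a b m a' b' m' h1 h2 _ _ h hm
    have := tripleRank_lt_choose h1 h2
    have h' : (m + 1).choose 3 ≤ m'.choose 3 := Nat.choose_le_choose 3 hm
    unfold tripleRank at *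
    omega
  have hl : l = l' := le_antisymm (not_lt.1 (key hij' hjl' hij hjl h.symm))
    (not_lt.1 (key hij hjl hij' hjl' h))
  subst hl
  have h0 : i + j.choose 2 = i' + j'.choose 2 := by unfold tripleRank at h; omega
  have key2 : ∀ {a b a' b' : ℕ}, a < b → a + b.choose 2 = a' + b'.choose 2 → ¬ b < b' := by
    intro a b a' b' h1 h hb
    have h2 : (b + 1).choose 2 = b + b.choose 2 := by
      rw [Nat.choose_succ_succ, Nat.choose_one_right]
    have h3 : (b + 1).choose 2 ≤ b'.choose 2 := Nat.choose_le_choose 2 hb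
    omega
  have hj : j = j' := le_antisymm (not_lt.1 (key2 hij' h0.symm)) (not_lt.1 (key2 hij h0))
  subst hj
  exact ⟨by omega, rfl, rfl⟩

theorem quadRanks_nodup {x y z t : ℕ} (h1 : x < y) (h2 : y < z) (h3 : z < t) :
    (quadRanks x y z t).Nodup := by
  have n1 : tripleRank x y z ≠ tripleRank x y t := fun h => by
    have := tripleRank_injective h1 h2 h1 (h2.trans h3) h; omega
  have n2 : tripleRank x y z ≠ tripleRank x z t := fun h => by
    have := tripleRank_injective h1 h2 (h1.trans h2) h3 h; omega
  have n3 : tripleRank x y z ≠ tripleRank y z t := fun h => by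
    have := tripleRank_injective h1 h2 h2 h3 h; omega
  have n4 : tripleRank x y t ≠ tripleRank x z t := fun h => by
    have := tripleRank_injective h1 (h2.trans h3) (h1.trans h2) h3 h; omega
  have n5 : tripleRank x y t ≠ tripleRank y z t := fun h => by
    have := tripleRank_injective h1 (h2.trans h3) h2 h3 h; omega
  have n6 : tripleRank x z t ≠ tripleRank y z t := fun h => by
    have := tripleRank_injective (h1.trans h2) h3 h2 h3 h; omega
  simp [quadRanks, *]

theorem QuadRelations.mono {M : Type*} [AddCommMonoid M] {m n : ℕ} {φ : (ℕ → Bool) → M}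
    (h : QuadRelations n φ) (hmn : m ≤ n) : QuadRelations m φ :=
  fun x y z t h1 h2 h3 h4 => h x y z t h1 h2 h3 (h4.trans_le hmn)

theorem QuadRelations.sum_eq_zero {M : Type*} [AddCommMonoid M] {n : ℕ} {φ : (ℕ → Bool) → M}
    (h : QuadRelations n φ) {q : List ℕ} (hq : q ∈ quadList n) (j : ℕ) (c : ℕ → Bool) :
    ∑ s ∈ q.toFinset.powersetCard j, φ (recolor q.toFinset s c) = 0 := by
  obtain ⟨x, y, z, t, h1, h2, h3, h4, rfl⟩ := mem_quadList.1 hq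
  exact h x y z t h1 h2 h3 h4 j c

theorem nodup_of_mem_quadList {n : ℕ} {q : List ℕ} (hq : q ∈ quadList n) : q.Nodup := by
  obtain ⟨x, y, z, t, h1, h2, h3, h4, rfl⟩ := mem_quadList.1 hq
  exact quadRanks_nodup h1 h2 h3

theorem quadRelations_iff {M : Type*} [AddCommMonoid M] {n : ℕ} {φ : (ℕ → Bool) → M} :
    QuadRelations n φ ↔ ∀ q ∈ quadList n, ∀ (j : ℕ) (c : ℕ → Bool),
      ∑ s ∈ q.toFinset.powersetCard j, φ (recolor q.toFinset s c) = 0 :=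
  ⟨fun h _ hq => h.sum_eq_zero hq, fun h x y z t h1 h2 h3 h4 =>
    h _ (mem_quadList.2 ⟨x, y, z, t, h1, h2, h3, h4, rfl⟩)⟩

/-! ### Restriction to an increasing family of positions -/

/-- The colouring `c`, with the values at the positions in `F` replaced by those of `d`. -/
def overlay (F : List ℕ) (d c : ℕ → Bool) : ℕ → Bool :=
  fun p => if p ∈ F then d (F.idxOf p) else c p

/-- Freezing the colours off `F` leaves a function of the colours on `F`; if `F` carries quadruples
to quadruples, its relations are instances of the original ones. This transfers the five-point
reductions to larger sets. -/
theorem QuadRelations.overlay {M : Type*} [AddCommMonoid M] {m n : ℕ} {φ : (ℕ → Bool) → M}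
    (h : QuadRelations n φ) {F : List ℕ} (hF : F.Nodup)
    (hq : ∀ q ∈ quadList m, (∀ i ∈ q, i < F.length) ∧ q.map (fun i => F.getD i 0) ∈ quadList n)
    (c : ℕ → Bool) : QuadRelations m (fun d => φ (overlay F d c)) := by
  rw [quadRelations_iff]
  intro q hqm j d
  obtain ⟨hlt, hmem⟩ := hq q hqm
  have hinj : Set.InjOn (fun i => F.getD i 0) (q.toFinset : Set ℕ) := by
    intro a ha b hb hab
    have ha' := hlt a (by simpa using ha)
    have hb' := hlt b (by simpa using hb)
    simp only [List.getD_eq_getElem _ _ ha', List.getD_eq_getElem _ _ hb'] at hab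
    exact (hF.getElem_inj_iff).1 hab
  have himg : (q.map (fun i => F.getD i 0)).toFinset = q.toFinset.image fun i => F.getD i 0 := by
    ext; simp
  have key := h.sum_eq_zero hmem j (_root_.overlay F d c)
  rw [← key, himg]
  refine Finset.sum_bij (fun s _ => s.image fun i => F.getD i 0) ?_ ?_ ?_ ?_
  · intro s hs
    rw [Finset.mem_powersetCard] at hs ⊢
    refine ⟨Finset.image_subset_image hs.1, ?_⟩
    rw [Finset.card_image_of_injOn (hinj.mono (by exact_mod_cast hs.1)), hs.2]
  · intro s hs s' hs' hss
    rw [Finset.mem_powersetCard] at hs hs'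
    refine Finset.coe_injective ((hinj.image_eq_image_iff (Finset.coe_subset.2 hs.1)
      (Finset.coe_subset.2 hs'.1)).1 ?_)
    simpa only [← Finset.coe_image, Finset.coe_inj] using hss
  · intro s hs
    rw [Finset.mem_powersetCard] at hs
    obtain ⟨s', hs', rfl⟩ := Finset.subset_image_iff.1 hs.1
    have hs'' : s' ⊆ q.toFinset := by exact_mod_cast hs'
    refine ⟨s', ?_, rfl⟩
    rw [Finset.mem_powersetCard]
    refine ⟨hs'', ?_⟩
    rw [← hs.2, Finset.card_image_of_injOn (hinj.mono (by exact_mod_cast hs''))]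
  · intro s hs
    rw [Finset.mem_powersetCard] at hs
    congr 1
    funext p
    by_cases hp : p ∈ F
    · obtain ⟨i, hi, rfl⟩ := List.mem_iff_getElem.1 hp
      have hmemiff : ∀ u : Finset ℕ, u ⊆ q.toFinset →
          ((F[i] ∈ u.image fun i => F.getD i 0) ↔ i ∈ u) := by
        intro u hu
        rw [Finset.mem_image]
        constructor
        · rintro ⟨a, ha, hai⟩
          have ha' := hlt a (by simpa using hu ha)
          rw [List.getD_eq_getElem _ _ ha'] at hai
          rwa [← (hF.getElem_inj_iff).1 hai]
        · intro hiu
          exact ⟨i, hiu, List.getD_eq_getElem _ _ hi⟩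
      simp only [_root_.overlay, recolor, hp, if_true, hmemiff s hs.1, hmemiff _ subset_rfl,
        hF.idxOf_getElem]
    · have hpq : p ∉ q.toFinset.image fun i => F.getD i 0 := by
        rw [Finset.mem_image]
        rintro ⟨a, ha, rfl⟩
        have ha' := hlt a (by simpa using ha)
        exact hp (by rw [List.getD_eq_getElem _ _ ha']; exact List.getElem_mem _)
      simp only [_root_.overlay, recolor, hp, if_false, hpq]

/-! ### Colourings as numbers -/

theorem exists_testBit_eq (N : ℕ) (c : ℕ → Bool) (h : ∀ p, N ≤ p → c p = false) :
    ∃ m < 2 ^ N, m.testBit = c := by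
  refine ⟨Nat.ofBits fun i : Fin N => c i, Nat.ofBits_lt_two_pow _, ?_⟩
  funext p
  rcases lt_or_ge p N with hp | hp
  · rw [Nat.testBit_ofBits_lt _ _ hp]
  · rw [Nat.testBit_ofBits_ge _ _ hp, h p hp]

theorem exists_testBit_of_lt {m n : ℕ} (h : m < n) :
    ∃ i, m.testBit i = false ∧ n.testBit i = true ∧ ∀ j, i < j → m.testBit j = n.testBit j := by
  have hne : m ^^^ n ≠ 0 := by
    rw [Ne, Nat.xor_eq_zero_iff]; exact h.ne
  obtain ⟨i, hi, hi'⟩ := Nat.exists_most_significant_bit hne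
  have hj : ∀ j, i < j → m.testBit j = n.testBit j := by
    intro j hj
    have := hi' j hj
    rw [Nat.testBit_xor] at this
    simpa using this
  rw [Nat.testBit_xor] at hi
  cases hm : m.testBit i <;> cases hn : n.testBit i <;> simp [hm, hn] at hi
  · exact ⟨i, hm, hn, hj⟩
  · exact absurd (Nat.lt_of_testBit i hn hm fun j h => (hj j h).symm) (by omega)

/-- The bits of `m` at the positions in `F`. -/
def gather : List ℕ → ℕ → ℕ
  | [], _ => 0
  | p :: F, m => (m.testBit p).toNat + 2 * gather F m

theorem testBit_gather (F : List ℕ) (m i : ℕ) (hi : i < F.length) :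
    (gather F m).testBit i = m.testBit (F.getD i 0) := by
  induction F generalizing i with
  | nil => simp at hi
  | cons p F ih =>
    cases i with
    | zero => cases h : m.testBit p <;> simp [gather, h, Nat.testBit_zero]
    | succ i =>
      have hdiv : gather (p :: F) m / 2 = gather F m := by
        cases h : m.testBit p <;> (simp [gather, h]; try omega)
      rw [Nat.testBit_succ, hdiv, ih i (by simpa using hi)]
      simp

theorem gather_lt (F : List ℕ) (m : ℕ) : gather F m < 2 ^ F.length := by
  induction F with
  | nil => simp [gather]
  | cons p F ih =>
    have := Bool.toNat_lt (m.testBit p)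
    simp only [gather, List.length_cons, pow_succ]
    omega

/-- A reduction of the colouring `gather F m` to smaller colourings of the positions in `F`
gives one of `m`. -/
theorem mem_span_lower_of_gather {k M : Type*} [Semiring k] [AddCommMonoid M] [Module k M]
    (φ : (ℕ → Bool) → M) {F : List ℕ} (hF : F.Pairwise (· < ·)) (m : ℕ)
    (h : φ (overlay F (gather F m).testBit m.testBit) ∈ Submodule.span k
      ((fun d : ℕ => φ (overlay F d.testBit m.testBit)) '' Set.Iio (gather F m))) :
    φ m.testBit ∈ Submodule.span k ((fun m : ℕ => φ m.testBit) '' Set.Iio m) := by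
  have hnd : F.Nodup := hF.imp fun h => h.ne
  have hself : overlay F (gather F m).testBit m.testBit = m.testBit := by
    funext p
    by_cases hp : p ∈ F
    · have hi := List.idxOf_lt_length_of_mem hp
      simp only [overlay, hp, if_true]
      rw [testBit_gather _ _ _ hi, List.getD_eq_getElem _ _ hi, List.getElem_idxOf]
    · simp [overlay, hp]
  rw [hself] at h
  refine Submodule.span_mono ?_ h
  rintro _ ⟨d, hd, rfl⟩
  -- Beyond some `N` the overlaid colouring is zero, so it is again the binary expansion of a
  -- number.
  obtain ⟨N, hN⟩ : ∃ N, ∀ p, N ≤ p → p ∉ F ∧ m.testBit p = false := by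
    refine ⟨max (F.sum + 1) m, fun p hp => ⟨fun hpF => ?_, ?_⟩⟩
    · have := List.single_le_sum (l := F) (by simp) p hpF
      omega
    · exact Nat.testBit_eq_false_of_lt (lt_of_le_of_lt (by omega) Nat.lt_two_pow_self)
  obtain ⟨m', -, hm'⟩ := exists_testBit_eq N (overlay F d.testBit m.testBit) (fun p hp => by
    simp [overlay, (hN p hp).1, (hN p hp).2])
  refine ⟨m', ?_, by simp only [hm']⟩
  -- Since `F` is increasing, the highest bit where `d` and `gather F m` differ becomes the highest
  -- bit where `m'` and `m` differ, so the order is preserved.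
  obtain ⟨i, hi1, hi2, hi3⟩ := exists_testBit_of_lt (show d < gather F m from hd)
  have hi : i < F.length := by
    by_contra hcon
    rw [Nat.testBit_eq_false_of_lt] at hi2
    · simp at hi2
    · exact (gather_lt F m).trans_le (Nat.pow_le_pow_right (by norm_num) (by omega))
  rw [testBit_gather _ _ _ hi, List.getD_eq_getElem _ _ hi] at hi2
  refine Nat.lt_of_testBit F[i] ?_ hi2 ?_
  · rw [hm']
    simp [overlay, List.getElem_mem, hnd.idxOf_getElem, hi1]
  · intro p hp
    rw [hm']
    by_cases hpF : p ∈ F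
    · obtain ⟨l, hl, rfl⟩ := List.mem_iff_getElem.1 hpF
      have hil : i < l := by
        by_contra hcon
        rcases (not_lt.1 hcon).eq_or_lt with rfl | hlt
        · exact lt_irrefl _ hp
        · exact lt_asymm hp (List.pairwise_iff_getElem.1 hF l i hl hi hlt)
      simp only [overlay, hpF, if_true, hnd.idxOf_getElem]
      rw [hi3 l hil, testBit_gather _ _ _ hl, List.getD_eq_getElem _ _ hl]
    · simp [overlay, hpF]

/-! ### Certificates -/

theorem sum_powersetCard_toFinset {α M : Type*} [DecidableEq α] [AddCommMonoid M] {q : List α}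
    (hq : q.Nodup) (j : ℕ) (f : Finset α → M) :
    ∑ s ∈ q.toFinset.powersetCard j, f s =
      ((q.sublistsLen j).map fun s => f s.toFinset).sum := by
  have hval : q.toFinset.val = (q : Multiset α) := by
    rw [List.toFinset_val, hq.dedup]
  have h1 : ∑ s ∈ q.toFinset.powersetCard j, f s =
      ((q.toFinset.val.powersetCard j).map fun t => f t.toFinset).sum := by
    rw [Finset.sum, Finset.powersetCard, Multiset.map_pmap]
    congr 1
    rw [← Multiset.pmap_eq_map (p := fun t => t.Nodup)]
    · refine Multiset.pmap_congr _ fun t _ h1 h2 => ?_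
      congr 1
      rw [← Finset.val_inj, Multiset.toFinset_val, h2.dedup]
    · exact fun t ht => Multiset.nodup_of_le (Multiset.mem_powersetCard.1 ht).1 q.toFinset.nodup
  rw [h1, hval, Multiset.powersetCard_coe, Multiset.map_coe, List.map_map, Multiset.sum_coe]
  rfl

/-- The numbers obtained from `m` by setting `j` of the bits at the positions in `q`. -/
def codesWith (q : List ℕ) (j m : ℕ) : List ℕ :=
  (q.sublistsLen j).map fun s => s.foldr (fun p a => 2 ^ p ||| a) m

theorem testBit_foldr_or (s : List ℕ) (m p : ℕ) :
    (s.foldr (fun p a => 2 ^ p ||| a) m).testBit p = (decide (p ∈ s) || m.testBit p) := by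
  induction s with
  | nil => simp
  | cons a s ih =>
    rw [List.foldr_cons, Nat.testBit_or, ih, Nat.testBit_two_pow]
    simp only [List.mem_cons, Bool.decide_or, eq_comm (a := a), Bool.or_assoc]

/-- The relations in the form that certificates evaluate. As `m` has no bits on `q`, setting the
bits of a subset of `q` recolours `q` exactly. -/
theorem QuadRelations.sum_codesWith {M : Type*} [AddCommMonoid M] {n : ℕ} {φ : (ℕ → Bool) → M}
    (h : QuadRelations n φ) {q : List ℕ} (hq : q ∈ quadList n) (j m : ℕ)
    (hm : ∀ p ∈ q, m.testBit p = false) :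
    ((codesWith q j m).map fun x => φ x.testBit).sum = 0 := by
  rw [← h.sum_eq_zero hq j m.testBit, sum_powersetCard_toFinset (nodup_of_mem_quadList hq),
    codesWith, List.map_map]
  congr 1
  refine List.map_congr_left fun s hs => ?_
  rw [List.mem_sublistsLen] at hs
  simp only [Function.comp]
  congr 1
  funext p
  rw [testBit_foldr_or]
  by_cases hp : p ∈ q
  · simp [recolor, hp, hm p hp]
  · have : p ∉ s := fun h => hp (hs.1.subset h)
    simp [recolor, hp, this]

/-- A linear combination of quadruple relations. The entry `(a, i, j, m)` stands for `a` times the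
relation for the `i`-th quadruple in which `j` of its entries are `true`, the other entries being
given by `m`. -/
abbrev Certificate : Type := List (ℤ × ℕ × ℕ × ℕ)

/-- The terms of the linear combination of quadruple relations. -/
def Certificate.terms (Q : List (List ℕ)) (C : Certificate) : List (ℤ × ℕ) :=
  C.flatMap fun r => (codesWith (Q.getD r.2.1 []) r.2.2.1 r.2.2.2).map fun x => (r.1, x)

/-- The coefficient of `x` in a formal sum. -/
def coeffOf (l : List (ℤ × ℕ)) (x : ℕ) : ℤ :=
  l.foldr (fun t a => if t.2 = x then t.1 + a else a) 0

/-- The certificate is well formed, and `m` is the largest colouring in the linear combination,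
with coefficient `1` or `-1`. -/
def Certificate.reduces (Q : List (List ℕ)) (C : Certificate) (m : ℕ) : Bool :=
  (C.all fun r => decide (r.2.1 < Q.length) &&
    (Q.getD r.2.1 []).all fun p => !r.2.2.2.testBit p) &&
  (let l := C.terms Q
   (coeffOf l m == 1 || coeffOf l m == -1) &&
     l.all fun t => Nat.ble t.2 m || coeffOf l t.2 == 0)

section
variable {k M : Type*} [Ring k] [AddCommGroup M] [Module k M]

/-- After like terms are collected, the leading coefficient is a unit, so the vanishing sum can be
solved for `f m`; terms above `m` may occur in `l` provided that they cancel. -/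
theorem mem_span_lower_of_sum_eq_zero (f : ℕ → M) (l : List (ℤ × ℕ)) (m : ℕ)
    (h0 : (l.map fun t => t.1 • f t.2).sum = 0)
    (hm : coeffOf l m = 1 ∨ coeffOf l m = -1)
    (hl : ∀ t ∈ l, t.2 ≤ m ∨ coeffOf l t.2 = 0) :
    f m ∈ Submodule.span k (f '' Set.Iio m) := by
  let F : ℕ →₀ ℤ := (l.map fun t => Finsupp.single t.2 t.1).sum
  have hF : ∀ x, F x = coeffOf l x := by
    intro x
    change (l.map fun t => Finsupp.single t.2 t.1).sum x = coeffOf l x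
    clear h0 hm hl F
    induction l with
    | nil => simp [coeffOf]
    | cons t l ih =>
      rw [List.map_cons, List.sum_cons, Finsupp.add_apply, ih, Finsupp.single_apply]
      simp only [coeffOf, List.foldr_cons]
      split_ifs <;> simp
  have hsupp : ∀ x ∈ F.support, x ≤ m := by
    intro x hx
    rw [Finsupp.mem_support_iff, hF] at hx
    have : ∃ t ∈ l, t.2 = x := by
      by_contra hcon
      push Not at hcon
      apply hx
      clear h0 hm hl hx hF F
      induction l with
      | nil => rfl
      | cons t l ih =>
        rw [coeffOf, List.foldr_cons, if_neg (hcon t (by simp))]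
        exact ih fun t ht => hcon t (by simp [ht])
    obtain ⟨t, ht, rfl⟩ := this
    exact (hl t ht).resolve_right hx
  have hsum : F.sum (fun x a => a • f x) = 0 := by
    rw [← h0, ← Finsupp.linearCombination_apply, map_list_sum, List.map_map]
    congr 1
    exact List.map_congr_left fun t _ => by simp
  have hrest : F.sum (fun x a => a • f x) = F m • f m + (F.erase m).sum fun x a => a • f x := by
    by_cases hmem : m ∈ F.support
    · exact (Finsupp.add_sum_erase F m (fun x a => a • f x) hmem).symm
    · rw [Finsupp.notMem_support_iff, hF] at hmem
      rw [hmem] at hm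
      simp at hm
  have hmem : (F.erase m).sum (fun x a => a • f x) ∈ Submodule.span k (f '' Set.Iio m) := by
    refine Submodule.sum_mem _ fun x hx => ?_
    rw [Finsupp.support_erase, Finset.mem_erase] at hx
    change (F.erase m) x • f x ∈ _
    rw [← Int.cast_smul_eq_zsmul k]
    exact Submodule.smul_mem _ _ (Submodule.subset_span
      ⟨x, lt_of_le_of_ne (hsupp x hx.2) hx.1, rfl⟩)
  rw [hsum, hF] at hrest
  rcases hm with hm | hm <;> rw [hm] at hrest
  · rw [one_smul] at hrest
    rw [eq_neg_of_add_eq_zero_left hrest.symm]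
    exact Submodule.neg_mem _ hmem
  · rw [neg_smul, one_smul] at hrest
    rw [neg_add_eq_zero.1 hrest.symm]
    exact hmem

theorem QuadRelations.mem_span_lower_of_reduces {n : ℕ} {φ : (ℕ → Bool) → M}
    (h : QuadRelations n φ) {C : Certificate} {m : ℕ} (hC : C.reduces (quadList n) m = true) :
    φ m.testBit ∈ Submodule.span k ((fun m : ℕ => φ m.testBit) '' Set.Iio m) := by
  simp only [Certificate.reduces, Bool.and_eq_true, Bool.or_eq_true, List.all_eq_true,
    decide_eq_true_eq, beq_iff_eq, Nat.ble_eq, Bool.not_eq_true'] at hC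
  obtain ⟨hval, hcoef, hle⟩ := hC
  refine mem_span_lower_of_sum_eq_zero (fun m : ℕ => φ m.testBit) (C.terms (quadList n)) m ?_
    hcoef hle
  clear hcoef hle
  induction C with
  | nil => rfl
  | cons r C ih =>
    have hr := hval r (by simp)
    have : ((codesWith ((quadList n).getD r.2.1 []) r.2.2.1 r.2.2.2).map
        fun x => r.1 • φ x.testBit).sum = 0 := by
      have hq : (quadList n).getD r.2.1 [] ∈ quadList n := by
        rw [List.getD_eq_getElem _ _ hr.1]; exact List.getElem_mem _
      have := h.sum_codesWith hq r.2.2.1 r.2.2.2 hr.2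
      rw [show (fun x : ℕ => r.1 • φ x.testBit) = (fun y => r.1 • y) ∘ fun x => φ x.testBit from rfl,
        ← List.map_map, ← List.smul_sum, this, smul_zero]
    rw [Certificate.terms, List.flatMap_cons, List.map_append, List.sum_append, List.map_map]
    refine (congrArg₂ (· + ·) this (ih fun t ht => hval t (by simp [ht]))).trans (add_zero _)

/-- If every `m < B` outside `S` reduces to smaller elements, then `S` spans. -/
theorem mem_span_of_lower (f : ℕ → M) (S : Set ℕ) (B : ℕ)
    (h : ∀ m < B, m ∉ S → f m ∈ Submodule.span k (f '' Set.Iio m)) :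
    ∀ m < B, f m ∈ Submodule.span k (f '' S) := by
  intro m
  induction m using Nat.strong_induction_on with
  | _ m ih =>
    intro hm
    by_cases hS : m ∈ S
    · exact Submodule.subset_span ⟨m, hS, rfl⟩
    · refine Submodule.span_le.2 ?_ (h m hm hS)
      rintro _ ⟨x, hx, rfl⟩
      exact ih x hx (lt_trans hx hm)

end

/-! ### Standard colourings -/

/-- The `i`-th quadruple relation having `m` as one of its terms. -/
def relationThrough (Q : List (List ℕ)) (m i : ℕ) : Certificate :=
  let s := (Q.getD i []).filter fun p => m.testBit p
  -- All bits in `s` are set in `m`, so the subtraction clears them, leaving the base colouring of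
  -- the relation.
  [(1, i, s.length, m - (s.map fun p => 2 ^ p).sum)]

/-- The colouring `m` is the largest term of a quadruple relation, or reducible by an element of
`T`. -/
def isReducible (Q : List (List ℕ)) (T : List (ℕ × Certificate)) (m : ℕ) : Bool :=
  ((List.range Q.length).any fun i => (relationThrough Q m i).reduces Q m) ||
    T.any fun t => t.1 == m && t.2.reduces Q m

theorem QuadRelations.mem_span_lower_of_isReducible {k M : Type*} [Ring k] [AddCommGroup M]
    [Module k M] {n : ℕ} {φ : (ℕ → Bool) → M} (h : QuadRelations n φ)
    {T : List (ℕ × Certificate)} {m : ℕ} (hm : isReducible (quadList n) T m = true) :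
    φ m.testBit ∈ Submodule.span k ((fun m : ℕ => φ m.testBit) '' Set.Iio m) := by
  simp only [isReducible, Bool.or_eq_true, List.any_eq_true, Bool.and_eq_true, beq_iff_eq] at hm
  rcases hm with ⟨i, -, hi⟩ | ⟨t, -, rfl, ht⟩
  · exact h.mem_span_lower_of_reduces hi
  · exact h.mem_span_lower_of_reduces ht

/-- Codes of the colourings of the four triples of `{0, …, 3}` that are standard. -/
def standardCodes4 : List ℕ :=
  [1, 2, 3, 4, 5, 6, 7, 9, 10, 11, 13]

/-- The standard colourings of the ten triples of `{0, …, 4}`. -/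
def standardCodes5 : List ℕ :=
  [29, 43, 57, 58, 59, 61, 85, 87, 93, 103, 139, 153, 154, 155, 157, 169, 170, 171, 173, 185, 186,
   187, 189, 195, 199, 203, 209, 210, 211, 212, 213, 214, 215, 217, 218, 219, 221, 227, 235, 277,
   279, 285, 295, 299, 313, 314, 315, 317, 341, 349, 391, 427, 541, 555, 569, 570, 571, 573, 597,
   605, 669, 797]

/-- Reductions of the nonstandard colourings of the triples of `{0, …, 4}` that are not the largest
term of a single quadruple relation. -/
def certificates5 : List (ℕ × Certificate) :=
  [(42, [(1, 3, 1, 10), (-1, 1, 0, 74)]), (71, [(1, 4, 3, 64), (-1, 3, 1, 14), (-1, 2, 0, 77),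
   (-1, 1, 0, 75)]), (84, [(1, 2, 0, 100), (-1, 3, 2, 4)]), (86, [(-1, 3, 2, 12), (1, 2, 0, 108),
   (1, 4, 2, 80), (-1, 1, 0, 90), (-1, 1, 0, 89)]), (99, [(1, 2, 0, 108), (-1, 4, 2, 96),
   (1, 3, 2, 10), (1, 2, 0, 105), (1, 3, 2, 6), (1, 2, 0, 101)]), (107, [(1, 3, 2, 14),
   (-1, 4, 3, 96), (1, 2, 0, 109)]), (137, [(1, 2, 1, 9), (-1, 1, 0, 265)]),
   (141, [(1, 3, 0, 142), (-1, 4, 3, 128)]), (193, [(1, 1, 1, 65), (-1, 2, 0, 577)]),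
   (197, [(1, 3, 1, 140), (-1, 4, 2, 192), (1, 3, 1, 138), (-1, 1, 0, 329), (1, 2, 1, 73),
   (1, 3, 1, 134)]), (201, [(1, 1, 0, 329), (-1, 2, 1, 73)]), (205, [(1, 3, 1, 142),
   (-1, 4, 3, 192)]), (225, [(1, 4, 0, 240), (-1, 3, 3, 128)]), (229, [(1, 0, 4, 1),
   (-1, 2, 1, 585), (1, 1, 2, 73), (-1, 2, 0, 617), (1, 1, 1, 89), (-1, 2, 0, 589), (1, 1, 1, 75),
   (1, 3, 2, 140), (-1, 4, 2, 224), (1, 3, 2, 138), (1, 3, 2, 134)]), (231, [(1, 0, 1, 182),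
   (-1, 1, 4, 18), (-1, 2, 4, 36), (-1, 3, 3, 134)]), (233, [(1, 3, 2, 140), (-1, 4, 2, 224),
   (1, 3, 2, 138)]), (237, [(1, 4, 3, 224), (-1, 3, 2, 142)]), (263, [(1, 3, 0, 270),
   (-1, 4, 3, 256), (1, 2, 1, 13), (1, 1, 0, 267)]), (276, [(1, 4, 1, 272), (-1, 1, 0, 280)]),
   (278, [(1, 2, 2, 12), (-1, 3, 0, 396), (-1, 4, 2, 272), (1, 1, 0, 282), (1, 1, 0, 281)]),
   (290, [(1, 3, 1, 258), (-1, 1, 0, 322)]), (291, [(1, 4, 2, 320), (-1, 3, 1, 268),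
   (-1, 3, 1, 266), (-1, 1, 0, 329), (-1, 3, 1, 262), (-1, 2, 1, 69), (-1, 1, 0, 323),
   (1, 4, 2, 288), (-1, 2, 1, 41), (-1, 2, 1, 37)]), (294, [(1, 4, 2, 288), (-1, 2, 1, 44),
   (1, 1, 0, 330), (-1, 3, 1, 266), (-1, 2, 1, 41)]), (298, [(1, 1, 0, 330), (-1, 3, 1, 266)]),
   (305, [(1, 4, 0, 368), (-1, 3, 3, 256), (1, 2, 1, 97), (1, 1, 0, 337)]), (306, [(1, 1, 2, 18),
   (-1, 0, 1, 146), (-1, 0, 1, 50), (-1, 0, 1, 22), (1, 2, 4, 0)]), (307, [(1, 0, 1, 147),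
   (-1, 1, 2, 19), (1, 0, 1, 51), (1, 0, 1, 23), (-1, 2, 4, 1)]), (308, [(1, 1, 4, 0),
   (-1, 0, 1, 164), (1, 2, 2, 36)]), (309, [(1, 1, 4, 1), (-1, 0, 1, 165), (1, 2, 2, 37)]),
   (310, [(1, 0, 1, 180), (-1, 1, 4, 16), (-1, 2, 3, 36), (-1, 1, 4, 2), (1, 0, 1, 166)]),
   (311, [(1, 1, 4, 17), (-1, 0, 1, 181), (1, 2, 3, 37), (-1, 0, 1, 167), (1, 1, 4, 3)]),
   (327, [(1, 3, 1, 270), (-1, 4, 3, 320), (1, 2, 1, 77), (1, 1, 0, 331)]), (340, [(1, 3, 2, 260),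
   (-1, 2, 1, 100)]), (342, [(1, 2, 1, 108), (-1, 3, 2, 268), (1, 4, 2, 336), (-1, 1, 0, 346),
   (-1, 1, 0, 345)]), (343, [(1, 0, 3, 19), (-1, 1, 1, 339), (-1, 1, 1, 283), (-1, 1, 1, 91),
   (1, 2, 4, 65), (1, 2, 4, 9), (1, 3, 4, 258), (-1, 1, 0, 347)]), (355, [(1, 4, 2, 352),
   (-1, 3, 2, 268), (-1, 3, 2, 266), (-1, 2, 1, 105), (-1, 3, 2, 262), (-1, 2, 1, 101)]),
   (359, [(1, 0, 2, 165), (-1, 1, 4, 257), (-1, 1, 4, 65), (-1, 1, 4, 9), (-1, 2, 2, 101),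
   (-1, 2, 2, 45), (1, 3, 4, 260)]), (363, [(1, 3, 2, 270), (-1, 4, 3, 352), (1, 2, 1, 109)]),
   (387, [(1, 1, 1, 259), (-1, 0, 2, 3), (1, 1, 1, 67), (1, 1, 1, 11)]), (395, [(1, 3, 0, 398),
   (-1, 4, 3, 384), (1, 2, 2, 13)]), (418, [(1, 2, 3, 32), (-1, 4, 0, 432)]), (419, [(1, 1, 3, 3),
   (-1, 0, 1, 163), (-1, 0, 1, 135), (-1, 0, 1, 39)]), (422, [(1, 1, 4, 2), (-1, 0, 1, 166)]),
   (423, [(1, 0, 1, 167), (-1, 1, 4, 3)]), (426, [(1, 4, 2, 416), (-1, 2, 2, 44)]),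
   (451, [(1, 4, 0, 496), (-1, 2, 3, 96), (1, 3, 2, 386), (-1, 2, 4, 64)]), (455, [(1, 3, 1, 398),
   (-1, 4, 3, 448), (1, 2, 2, 77), (-1, 0, 4, 3), (1, 1, 1, 331)]), (459, [(1, 0, 4, 3),
   (-1, 1, 1, 331)]), (483, [(1, 2, 3, 97), (-1, 3, 4, 384)]), (487, [(1, 2, 4, 100),
   (-1, 3, 3, 390)]), (491, [(1, 2, 4, 104), (-1, 3, 3, 394)]), (554, [(1, 3, 1, 522),
   (-1, 1, 1, 74)]), (583, [(1, 4, 3, 576), (-1, 3, 1, 526), (-1, 2, 0, 589), (-1, 1, 1, 75)]),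
   (596, [(1, 2, 0, 612), (-1, 3, 2, 516)]), (598, [(1, 2, 0, 620), (-1, 3, 2, 524),
   (1, 4, 2, 592), (-1, 1, 1, 90), (-1, 1, 1, 89)]), (599, [(1, 1, 2, 275), (-1, 2, 4, 513),
   (-1, 0, 2, 51), (-1, 0, 2, 23), (1, 3, 4, 514)]), (611, [(1, 2, 4, 512), (-1, 1, 2, 274),
   (1, 0, 2, 50), (1, 0, 2, 22), (-1, 3, 3, 514)]), (615, [(1, 1, 3, 274), (-1, 2, 4, 544),
   (-1, 2, 4, 516), (-1, 0, 2, 54), (1, 3, 3, 518)]), (619, [(1, 3, 2, 526), (-1, 4, 3, 608),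
   (1, 2, 0, 621)]), (653, [(1, 3, 0, 654), (-1, 4, 3, 640)]), (709, [(1, 2, 1, 581),
   (-1, 0, 3, 5), (1, 2, 1, 525)]), (711, [(1, 2, 4, 516), (-1, 0, 2, 150), (1, 3, 2, 646),
   (-1, 1, 4, 66)]), (717, [(1, 0, 4, 5), (-1, 2, 1, 589)]), (724, [(1, 1, 4, 64),
   (-1, 3, 2, 644)]), (725, [(1, 3, 4, 640), (-1, 1, 3, 81)]), (726, [(1, 3, 2, 646),
   (-1, 1, 4, 66)]), (727, [(1, 2, 4, 517), (-1, 0, 2, 151)]), (733, [(1, 1, 3, 89),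
   (-1, 3, 4, 648)]), (810, [(1, 0, 4, 2), (-1, 3, 1, 778)]), (811, [(1, 3, 1, 782),
   (-1, 0, 4, 6), (-1, 4, 3, 800), (1, 2, 1, 557)]), (825, [(1, 3, 4, 768), (-1, 0, 3, 49)]),
   (826, [(1, 1, 2, 282), (-1, 2, 4, 520)]), (827, [(1, 3, 4, 770), (-1, 0, 3, 51)]),
   (829, [(1, 1, 4, 265), (-1, 2, 2, 557)])]

/-- Reductions of four colourings of the triples of `{0, …, 5}`. -/
def certificates6 : List (ℕ × Certificate) :=
  [(85597, [(1, 4, 3, 85013), (-1, 7, 4, 66385), (1, 3, 1, 76629), (-1, 10, 2, 68437),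
   (-1, 2, 0, 85789)]), (87613, [(1, 10, 1, 72253), (1, 2, 1, 85564), (-1, 6, 4, 17948),
   (-1, 9, 4, 18988), (-1, 12, 3, 82492)]), (103741, [(1, 10, 0, 104765), (1, 2, 1, 101692),
   (-1, 6, 4, 34076), (-1, 9, 4, 35116), (-1, 12, 3, 98620)]), (231643, [(1, 7, 2, 196827),
   (-1, 1, 1, 106715), (1, 5, 4, 32859)])]

theorem isReducible_of_notMem_standardCodes4 :
    ∀ m < 16, m ∉ standardCodes4 → isReducible (quadList 4) [] m = true := by
  have h : ((List.range 16).all fun m =>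
      standardCodes4.contains m || isReducible (quadList 4) [] m) = true := by
    decide +kernel
  intro m hm hS
  have := List.all_eq_true.1 h m (List.mem_range.2 hm)
  simpa [hS] using this

theorem isReducible_of_notMem_standardCodes5 :
    ∀ m < 1024, m ∉ standardCodes5 → isReducible (quadList 5) certificates5 m = true := by
  have h : ((List.range 1024).all fun m =>
      standardCodes5.contains m || isReducible (quadList 5) certificates5 m) = true := by
    decide +kernel
  intro m hm hS
  have := List.all_eq_true.1 h m (List.mem_range.2 hm)
  simpa [hS] using this

/-! ### Search for colourings that are standard on every five-element subset -/

/-- The ranks of the ten triples contained in the five-element subsets of `{0, …, n - 1}`. -/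
def fiveList (n : ℕ) : List (List ℕ) :=
  ((List.range n).sublistsLen 5).map fun v =>
    [(0, 1, 2), (0, 1, 3), (0, 2, 3), (1, 2, 3), (0, 1, 4), (0, 2, 4), (1, 2, 4), (0, 3, 4),
      (1, 3, 4), (2, 3, 4)].map fun t => tripleRank (v.getD t.1 0) (v.getD t.2.1 0) (v.getD t.2.2 0)

/-- The extensions of the numbers in `L`, regarded as colourings of `{0, …, i - 1}`, by one bit for
each entry of `stages`, for which the subsets in that entry are coloured as prescribed by the bits
of `S`. -/
def extendCodes (S : ℕ) : List (List (List ℕ)) → ℕ → List ℕ → List ℕ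
  | [], _, L => L
  | Fs :: stages, i, L => extendCodes S stages (i + 1) <|
      L.flatMap fun m => [m, 2 ^ i + m].filter fun m => Fs.all fun F => S.testBit (gather F m)

/-- The members of `Fs` with largest entry `i`, `i + 1`, …, `i + l - 1`. -/
def stagesOf (Fs : List (List ℕ)) (i l : ℕ) : List (List (List ℕ)) :=
  (List.range' i l).map fun i => Fs.filter fun F => F.contains i && F.all fun p => Nat.ble p i

theorem gather_mod (F : List ℕ) (m i : ℕ) (h : ∀ p ∈ F, p < i) :
    gather F (m % 2 ^ i) = gather F m := by
  induction F with
  | nil => rfl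
  | cons p F ih =>
    rw [gather, gather, ih fun p hp => h p (by simp [hp]), Nat.testBit_mod_two_pow]
    simp [h p (by simp)]

/-- Completeness of the search: each condition `F` is tested once the bit at its largest entry is
added, and by then the truncation of `m` has all bits it needs, so no truncation of an admissible
`m` is discarded. -/
theorem mod_mem_extendCodes (S : ℕ) (Fs : List (List ℕ)) (m : ℕ)
    (h : ∀ F ∈ Fs, S.testBit (gather F m) = true) (l i : ℕ) (L : List ℕ) (hL : m % 2 ^ i ∈ L) :
    m % 2 ^ (i + l) ∈ extendCodes S (stagesOf Fs i l) i L := by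
  induction l generalizing i L with
  | zero => simpa [stagesOf, extendCodes] using hL
  | succ l ih =>
    rw [stagesOf, List.range'_succ, List.map_cons, extendCodes, ← add_assoc, add_right_comm]
    refine ih (i + 1) _ ?_
    simp only [List.mem_flatMap, List.mem_filter, List.all_eq_true, Bool.and_eq_true, Nat.ble_eq]
    refine ⟨m % 2 ^ i, hL, ?_, ?_⟩
    · rw [Nat.mod_pow_succ]
      rcases Nat.mod_two_eq_zero_or_one (m / 2 ^ i) with h2 | h2 <;> simp [h2, add_comm]
    · rintro F ⟨hF, -, hFi⟩
      rw [gather_mod F m (i + 1) fun p hp => Nat.lt_succ_of_le (hFi p hp)]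
      exact h F hF

/-- The number whose nonzero bits are at the positions in `standardCodes5`. -/
def standardMask5 : ℕ :=
  833501804109981784259981473840157224645544231944817191268139454858900218727715558442819469560044064325340325369515978037917368305737543393404505393382223661618944929001222229315714195619552627318338296971784963014175166463802463724691783680

/-- Encoding the list as one number turns membership into a single bit test, which keeps the search
cheap to evaluate. -/
theorem testBit_standardMask5 : ∀ m < 1024,
    standardMask5.testBit m = standardCodes5.contains m := by
  have h : ((List.range 1024).all fun m =>
      standardMask5.testBit m == standardCodes5.contains m) = true := by
    decide +kernel
  intro m hm
  simpa using List.all_eq_true.1 h m (List.mem_range.2 hm)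

theorem extendCodes_six : extendCodes standardMask5 (stagesOf (fiveList 6) 10 10) 10
    standardCodes5 = [231643, 103741, 87613, 85597, 79645] := by
  decide +kernel

theorem extendCodes_seven : extendCodes standardMask5 (stagesOf (fiveList 7) 20 15) 20
    [231643, 103741, 87613, 85597, 79645] = [] := by
  decide +kernel

theorem isReducible_certificates6 : ∀ m ∈ [85597, 87613, 103741, 231643],
    isReducible (quadList 6) certificates6 m = true := by
  decide +kernel

/-- Exactly the hypotheses needed to restrict relations to a five-element subset and to keep the
order on colourings. -/
theorem fiveList_spec : ∀ n ∈ [6, 7], ∀ F ∈ fiveList n, F.length = 10 ∧ F.Pairwise (· < ·) ∧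
    ∀ q ∈ quadList 5, (∀ i ∈ q, i < F.length) ∧ q.map (fun i => F.getD i 0) ∈ quadList n := by
  decide +kernel

/-! ### Spanning sets -/

section
variable {k M : Type*} [Ring k] [AddCommGroup M] [Module k M]

theorem QuadRelations.mem_span_standardCodes4 {φ : (ℕ → Bool) → M} (h : QuadRelations 4 φ) :
    ∀ m < 16, φ m.testBit ∈ Submodule.span k
      ((fun m : ℕ => φ m.testBit) '' {m | m ∈ standardCodes4}) :=
  mem_span_of_lower _ _ _ fun m hm hS => h.mem_span_lower_of_isReducible
    (isReducible_of_notMem_standardCodes4 m hm hS)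

theorem QuadRelations.mem_span_standardCodes5 {φ : (ℕ → Bool) → M} (h : QuadRelations 5 φ) :
    ∀ m < 1024, φ m.testBit ∈ Submodule.span k
      ((fun m : ℕ => φ m.testBit) '' {m | m ∈ standardCodes5}) :=
  mem_span_of_lower _ _ _ fun m hm hS => h.mem_span_lower_of_isReducible
    (isReducible_of_notMem_standardCodes5 m hm hS)

/-! ### Homogeneity of the relations on five points -/

/-- The number of entries `true` among the first ten entries of a colouring. -/
def trueCount (c : ℕ → Bool) : ℕ := ((Finset.range 10).filter fun p => c p = true).card

theorem trueCount_recolor {q s : Finset ℕ} (hq : q ⊆ Finset.range 10) (hs : s ⊆ q)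
    (c : ℕ → Bool) :
    trueCount (recolor q s c) = s.card + ((Finset.range 10 \ q).filter fun p => c p = true).card := by
  have : (Finset.range 10).filter (fun p => recolor q s c p = true) =
      s ∪ (Finset.range 10 \ q).filter fun p => c p = true := by
    ext p
    by_cases hp : p ∈ q
    · have := hq hp
      simp [recolor, hp] at this ⊢
      omega
    · have : p ∉ s := fun h => hp (hs h)
      simp [recolor, hp, this]
  rw [trueCount, this, Finset.card_union_of_disjoint]
  rw [Finset.disjoint_left]
  intro p hp hp'
  simp at hp'
  exact hp'.1.2 (hs hp)

theorem quadList_five_lt : ∀ q ∈ quadList 5, ∀ p ∈ q, p < 10 := by decide +kernel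

/-- All terms of one relation have the same number of `true` entries, so truncation to one weight
keeps or kills a relation as a whole. -/
theorem QuadRelations.ite_trueCount {φ : (ℕ → Bool) → M} (h : QuadRelations 5 φ) (w : ℕ) :
    QuadRelations 5 fun c => if trueCount c = w then φ c else 0 := by
  rw [quadRelations_iff]
  intro q hq j c
  have hq10 : q.toFinset ⊆ Finset.range 10 := by
    intro p hp
    exact Finset.mem_range.2 (quadList_five_lt q hq p (by simpa using hp))
  have hw : ∀ s ∈ q.toFinset.powersetCard j, trueCount (recolor q.toFinset s c) =
      j + ((Finset.range 10 \ q.toFinset).filter fun p => c p = true).card := by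
    intro s hs
    rw [Finset.mem_powersetCard] at hs
    rw [trueCount_recolor hq10 hs.1, hs.2]
  rw [Finset.sum_congr rfl fun s hs => by rw [hw s hs]]
  split_ifs
  · exact h.sum_eq_zero hq j c
  · simp

theorem QuadRelations.mem_span_standardCodes5_trueCount {φ : (ℕ → Bool) → M}
    (h : QuadRelations 5 φ) (m : ℕ) (hm : m < 1024) :
    φ m.testBit ∈ Submodule.span k ((fun m : ℕ => φ m.testBit) ''
      {x | x ∈ standardCodes5 ∧ trueCount x.testBit = trueCount m.testBit}) := by
  -- Applying the spanning result to the truncated function removes the standard colourings of every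
  -- other weight.
  have := (h.ite_trueCount (trueCount m.testBit)).mem_span_standardCodes5 (k := k) m hm
  simp only [if_true] at this
  refine Submodule.span_le.2 ?_ this
  rintro _ ⟨x, hx, rfl⟩
  dsimp only
  split_ifs with hw
  · exact Submodule.subset_span ⟨x, ⟨hx, hw⟩, rfl⟩
  · exact Submodule.zero_mem _

/-! ### Six and more points -/

theorem QuadRelations.mem_span_lower_of_fiveList {n : ℕ} (hn : n ∈ [6, 7]) {φ : (ℕ → Bool) → M}
    (h : QuadRelations n φ) {F : List ℕ} (hF : F ∈ fiveList n) {m : ℕ}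
    (hm : gather F m ∉ standardCodes5) :
    φ m.testBit ∈ Submodule.span k ((fun m : ℕ => φ m.testBit) '' Set.Iio m) := by
  obtain ⟨hlen, hlt, hq⟩ := fiveList_spec n hn F hF
  refine mem_span_lower_of_gather φ hlt m ?_
  refine (h.overlay (hlt.imp fun h => h.ne) hq m.testBit).mem_span_lower_of_isReducible
    (isReducible_of_notMem_standardCodes5 _ ?_ hm)
  have := gather_lt F m
  rwa [hlen] at this

theorem testBit_standardMask5_gather {n : ℕ} (hn : n ∈ [6, 7]) {m : ℕ}
    (h : ∀ F ∈ fiveList n, gather F m ∈ standardCodes5) :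
    ∀ F ∈ fiveList n, standardMask5.testBit (gather F m) = true := by
  intro F hF
  have hlt := gather_lt F m
  rw [(fiveList_spec n hn F hF).1] at hlt
  rw [testBit_standardMask5 _ hlt]
  simpa using h F hF

theorem gather_range (N m : ℕ) : gather (List.range N) m = m % 2 ^ N := by
  refine Nat.eq_of_testBit_eq fun i => ?_
  rw [Nat.testBit_mod_two_pow]
  rcases lt_or_ge i N with hi | hi
  · rw [testBit_gather _ _ _ (by simpa using hi)]
    simp [hi]
  · rw [Nat.testBit_eq_false_of_lt]
    · simp [hi]
    · have := gather_lt (List.range N) m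
      rw [List.length_range] at this
      exact this.trans_le (Nat.pow_le_pow_right (by norm_num) hi)

theorem range_ten_mem_fiveList : ∀ n ∈ [6, 7], List.range 10 ∈ fiveList n := by
  decide +kernel

theorem mod_mem_of_gather_mem {n : ℕ} (hn : n ∈ [6, 7]) {m : ℕ}
    (h : ∀ F ∈ fiveList n, gather F m ∈ standardCodes5) : m % 2 ^ 10 ∈ standardCodes5 := by
  rw [← gather_range]
  exact h _ (range_ten_mem_fiveList n hn)

theorem fiveList_six_subset : ∀ F ∈ fiveList 6, F ∈ fiveList 7 := by
  decide +kernel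

theorem mod_mem_of_gather_mem_six {m : ℕ}
    (h : ∀ F ∈ fiveList 6, gather F m ∈ standardCodes5) :
    m % 2 ^ 20 ∈ [231643, 103741, 87613, 85597, 79645] := by
  rw [← extendCodes_six]
  exact mod_mem_extendCodes _ _ m (testBit_standardMask5_gather (by simp) h) 10 10 _
    (mod_mem_of_gather_mem (n := 6) (by simp) h)

theorem exists_gather_notMem_seven (m : ℕ) :
    ∃ F ∈ fiveList 7, gather F m ∉ standardCodes5 := by
  by_contra! h
  have h6 := mod_mem_of_gather_mem_six fun F hF => h F (fiveList_six_subset F hF)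
  have := mod_mem_extendCodes _ _ m (testBit_standardMask5_gather (by simp) h) 15 20 _ h6
  rw [extendCodes_seven] at this
  simp at this

/-- A colouring nonstandard on some five-element subset reduces there. Of the five remaining
candidates, four reduce by `certificates6`. -/
theorem QuadRelations.mem_span_six {φ : (ℕ → Bool) → M} (h : QuadRelations 6 φ) :
    ∀ m < 2 ^ 20, φ m.testBit ∈ Submodule.span k ((fun m : ℕ => φ m.testBit) '' {79645}) := by
  refine mem_span_of_lower _ _ _ fun m hm hS => ?_
  by_cases hF : ∀ F ∈ fiveList 6, gather F m ∈ standardCodes5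
  · have := mod_mem_of_gather_mem_six hF
    rw [Nat.mod_eq_of_lt hm] at this
    refine h.mem_span_lower_of_isReducible (isReducible_certificates6 m ?_)
    simp only [List.mem_cons, List.not_mem_nil, or_false, Set.mem_singleton_iff] at this hS ⊢
    tauto
  · push Not at hF
    obtain ⟨F, hF, hmF⟩ := hF
    exact h.mem_span_lower_of_fiveList (by simp) hF hmF

theorem QuadRelations.eq_zero_of_seven {φ : (ℕ → Bool) → M} (h : QuadRelations 7 φ) (m : ℕ) :
    φ m.testBit = 0 := by
  -- Every colouring reduces, so the empty set already spans.
  have := mem_span_of_lower (k := ℤ) (fun m : ℕ => φ m.testBit) ∅ (m + 1) (fun m _ _ => by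
    obtain ⟨F, hF, hmF⟩ := exists_gather_notMem_seven m
    exact h.mem_span_lower_of_fiveList (by simp) hF hmF) m (Nat.lt_succ_self m)
  simpa using this

theorem quadList_seven_lt : ∀ q ∈ quadList 7, ∀ p ∈ q, p < 35 := by decide +kernel

theorem QuadRelations.eq_zero {n : ℕ} (hn : 7 ≤ n) {φ : (ℕ → Bool) → M}
    (h : QuadRelations n φ) (c : ℕ → Bool) : φ c = 0 := by
  have hid : ∀ q ∈ quadList 7, q.map (fun i => (List.range 35).getD i 0) = q := by
    intro q hq
    conv_rhs => rw [← List.map_id q]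
    refine List.map_congr_left fun i hi => ?_
    have := quadList_seven_lt q hq i hi
    simp [List.getD_eq_getElem, this]
  -- In colexicographic order the triples of the first seven points occupy the first `35` positions,
  -- whatever `n` is; the other colours are frozen.
  have h7 : QuadRelations 7 fun d => φ (_root_.overlay (List.range 35) d c) := by
    refine (h.mono hn).overlay List.nodup_range (fun q hq => ⟨?_, ?_⟩) c
    · simpa using quadList_seven_lt q hq
    · rw [hid q hq]; exact hq
  obtain ⟨m, -, hm⟩ := exists_testBit_eq 35 (fun p => if p < 35 then c p else false)
    (fun p hp => by simp [not_lt.2 hp])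
  have := h7.eq_zero_of_seven m
  rw [hm] at this
  convert this using 2
  funext p
  by_cases hp : p < 35
  · have : (List.range 35).idxOf p = p := by
      have := (List.nodup_range (n := 35)).idxOf_getElem p (by simpa using hp)
      simpa using this
    simp [_root_.overlay, hp, this]
  · simp [_root_.overlay, hp]

end

/-! ### The quadruple relations in `Λ^{S³}` -/

/-- The rank of a triple in the colexicographic order. -/
def Triple.rank {n : ℕ} (s : Triple n) : ℕ := tripleRank s.1.1 s.1.2.1 s.1.2.2

theorem Triple.rank_injective (n : ℕ) : Function.Injective (Triple.rank (n := n)) := by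
  rintro ⟨⟨i, j, l⟩, hij, hjl⟩ ⟨⟨i', j', l'⟩, hij', hjl'⟩ h
  obtain ⟨h1, h2, h3⟩ := tripleRank_injective (Fin.lt_def.1 hij) (Fin.lt_def.1 hjl)
    (Fin.lt_def.1 hij') (Fin.lt_def.1 hjl') h
  simp only [Subtype.mk.injEq, Prod.mk.injEq, Fin.ext_iff]
  exact ⟨h1, h2, h3⟩

theorem Triple.rank_lt {n : ℕ} (s : Triple n) : s.rank < n.choose 3 :=
  (tripleRank_lt_choose (Fin.lt_def.1 s.2.1) (Fin.lt_def.1 s.2.2)).trans_le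
    (Nat.choose_le_choose 3 s.1.2.2.2)

/-- If a polynomial expression in `b` vanishes identically, so do its homogeneous parts. -/
theorem sum_powersetCard_eq_zero_of_forall {k M ι : Type*} [Field k] [Infinite k]
    [AddCommGroup M] [Module k M] (Q : Finset ι) (A : Finset ι → M)
    (h : ∀ b : k, ∑ s ∈ Q.powerset, b ^ s.card • A s = 0) (j : ℕ) :
    ∑ s ∈ Q.powersetCard j, A s = 0 := by
  -- Linear functionals reduce the claim to a scalar polynomial with every element of an infinite
  -- field as a root.
  rw [← Module.forall_dual_apply_eq_zero_iff k]
  intro g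
  let P : Polynomial k := ∑ s ∈ Q.powerset, Polynomial.C (g (A s)) * Polynomial.X ^ s.card
  have hP : P = 0 := by
    refine Polynomial.funext fun b => ?_
    have := congrArg g (h b)
    simp only [map_sum, map_smul, smul_eq_mul, map_zero] at this
    simp only [P, Polynomial.eval_finsetSum, Polynomial.eval_mul, Polynomial.eval_C,
      Polynomial.eval_pow, Polynomial.eval_X, Polynomial.eval_zero]
    rw [← this]
    exact Finset.sum_congr rfl fun s _ => mul_comm _ _
  have := congrArg (fun p => Polynomial.coeff p j) hP
  simp only [P, Polynomial.finsetSum_coeff, Polynomial.coeff_C_mul, Polynomial.coeff_X_pow,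
    Polynomial.coeff_zero, mul_ite, mul_one, mul_zero, ← Finset.sum_filter] at this
  rw [map_sum, ← this]
  refine Finset.sum_congr ?_ fun _ _ => rfl
  ext s
  simp [Finset.mem_powersetCard, eq_comm]

section
variable {k V : Type*} [Field k] [AddCommGroup V] [Module k V]

/-- The class of the simple tensor whose entries are the basis vectors given by a colouring. -/
noncomputable def colorClass (e : Module.Basis (Fin 2) k V) (n : ℕ) (c : ℕ → Bool) : LambdaS3 k V n :=
  (ExtRelS3 k V n).mkQ (PiTensorProduct.tprod k fun s : Triple n => e (if c s.rank then 1 else 0))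

theorem quadRelations_colorClass [Infinite k] (e : Module.Basis (Fin 2) k V) (n : ℕ) :
    QuadRelations n (colorClass e n) := by
  intro x y z t hxy hyz hzt htn j c
  let X : Fin n := ⟨x, by omega⟩
  let Y : Fin n := ⟨y, by omega⟩
  let Z : Fin n := ⟨z, by omega⟩
  let T : Fin n := ⟨t, htn⟩
  have hXY : X < Y := hxy
  have hYZ : Y < Z := hyz
  have hZT : Z < T := hzt
  let Q : Finset (Triple n) := {Triple.of X Y Z hXY hYZ, Triple.of X Y T hXY (hYZ.trans hZT),
    Triple.of X Z T (hXY.trans hYZ) hZT, Triple.of Y Z T hYZ hZT}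
  let r : Triple n ↪ ℕ := ⟨Triple.rank, Triple.rank_injective n⟩
  have hQ : (quadRanks x y z t).toFinset = Q.map r := by
    ext p
    simp [quadRanks, Q, r, Triple.rank, Triple.of, X, Y, Z, T]
  let f : MultilinearMap k (fun _ : Triple n => V) (LambdaS3 k V n) :=
    (ExtRelS3 k V n).mkQ.compMultilinearMap (PiTensorProduct.tprod k)
  let m' : Triple n → V := Q.piecewise (fun _ => e 0) fun s => e (if c s.rank then 1 else 0)
  have hterm : ∀ s ⊆ Q, colorClass e n (recolor (Q.map r) (s.map r) c) =
      f (s.piecewise (fun _ => e 1) m') := by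
    intro s hs
    simp only [colorClass, f, LinearMap.compMultilinearMap_apply]
    congr 2
    funext u
    have hu : ∀ P : Finset (Triple n), u.rank ∈ P.map r ↔ u ∈ P := fun P =>
      Finset.mem_map' r
    by_cases hus : u ∈ s
    · simp [recolor, hu, hus, hs hus]
    · by_cases huQ : u ∈ Q <;> simp [recolor, hu, hus, huQ, m']
  rw [hQ, Finset.powersetCard_map, Finset.sum_map]
  refine (Finset.sum_congr rfl fun s hs => hterm s (Finset.mem_powersetCard.1 hs).1).trans ?_
  refine sum_powersetCard_eq_zero_of_forall (k := k) Q _ (fun b => ?_) j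
  -- All four entries on the quadruple equal `b • e 1 + e 0`. Multilinear expansion gives one term
  -- for each subset of `Q`, with factor `b` to its cardinality.
  have hzero : f (Q.piecewise ((fun _ => b • e 1) + m') m') = 0 := by
    simp only [f, LinearMap.compMultilinearMap_apply]
    rw [Submodule.mkQ_apply, Submodule.Quotient.mk_eq_zero]
    refine Submodule.subset_span ⟨_, ⟨X, Y, Z, T, hXY, hYZ, hZT, ?_⟩, rfl⟩
    have hval : ∀ s ∈ Q, Q.piecewise ((fun _ => b • e 1) + m') m' s = b • e 1 + e 0 := by
      intro s hs
      simp [hs, m']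
    rw [hval _ (by simp [Q]), hval _ (by simp [Q]), hval _ (by simp [Q]), hval _ (by simp [Q])]
    exact ⟨rfl, rfl, rfl⟩
  rw [MultilinearMap.map_piecewise_add] at hzero
  rw [← hzero]
  refine Finset.sum_congr rfl fun s _ => ?_
  have hs : s.piecewise (fun _ => b • e 1) m' =
      s.piecewise (fun i => b • s.piecewise (fun _ => e 1) m' i)
        (s.piecewise (fun _ => e 1) m') := by
    funext u
    by_cases hu : u ∈ s <;> simp [hu]
  rw [hs, MultilinearMap.map_piecewise_smul, Finset.prod_const]

theorem exists_testBit_rank {n : ℕ} (d : Triple n → Fin 2) :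
    ∃ m < 2 ^ n.choose 3, ∀ s : Triple n, (if m.testBit s.rank then 1 else 0) = d s := by
  classical
  obtain ⟨m, hm, hm'⟩ := exists_testBit_eq (n.choose 3)
    (fun p => decide (∃ s : Triple n, s.rank = p ∧ d s = 1)) (fun p hp => by
      rw [decide_eq_false_iff_not]
      rintro ⟨s, rfl, -⟩
      exact absurd s.rank_lt (not_lt.2 hp))
  refine ⟨m, hm, fun s => ?_⟩
  have : (∃ s' : Triple n, s'.rank = s.rank ∧ d s' = 1) ↔ d s = 1 :=
    ⟨fun ⟨s', h1, h2⟩ => Triple.rank_injective n h1 ▸ h2, fun h => ⟨s, rfl, h⟩⟩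
  rw [hm']
  simp only [this]
  generalize d s = i
  fin_cases i <;> rfl

theorem span_colorClass (e : Module.Basis (Fin 2) k V) (n : ℕ) :
    Submodule.span k ((fun m : ℕ => colorClass e n m.testBit) '' Set.Iio (2 ^ n.choose 3)) = ⊤ := by
  rw [eq_top_iff, ← (ExtRelS3 k V n).range_mkQ, LinearMap.range_eq_map,
    ← (Basis.piTensorProduct fun _ : Triple n => e).span_eq, Submodule.map_span,
    Submodule.span_le]
  rintro _ ⟨_, ⟨d, rfl⟩, rfl⟩
  obtain ⟨m, hm, hd⟩ := exists_testBit_rank d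
  refine Submodule.subset_span ⟨m, hm, ?_⟩
  rw [Basis.piTensorProduct_apply]
  simp only [colorClass, hd]

theorem span_colorClass_of_forall_mem {e : Module.Basis (Fin 2) k V} {n : ℕ} {S : Set ℕ}
    (h : ∀ m < 2 ^ n.choose 3, colorClass e n m.testBit ∈
      Submodule.span k ((fun m : ℕ => colorClass e n m.testBit) '' S)) :
    Submodule.span k ((fun m : ℕ => colorClass e n m.testBit) '' S) = ⊤ := by
  rw [eq_top_iff, ← span_colorClass e n, Submodule.span_le]
  rintro _ ⟨m, hm, rfl⟩
  exact h m hm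

end

/-! ### Determinants of integer matrices given by lists -/

/-- The determinant of the submatrix on the columns `J` of the matrix with rows `M`, by expansion
along the first row. -/
def minorDet : List (List ℤ) → List ℕ → ℤ
  | [], _ => 1
  | r :: M, J => (List.range J.length).foldr (fun j a =>
      let x := r.getD (J.getD j 0) 0
      -- Zero entries skip their minors. Nested subtraction produces the alternating signs.
      if x = 0 then -a else x * minorDet M (J.eraseIdx j) - a) 0

theorem foldr_range_eq_sum (n : ℕ) (f : ℕ → ℤ) :
    (List.range n).foldr (fun j a => f j - a) 0 = ∑ j : Fin n, (-1) ^ (j : ℕ) * f j := by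
  induction n generalizing f with
  | zero => simp
  | succ n ih =>
    rw [List.range_succ_eq_map, List.foldr_cons, List.foldr_map, ih fun j => f (j + 1),
      Fin.sum_univ_succ]
    simp [pow_succ, sub_eq_add_neg]

theorem minorDet_eq_det (n : ℕ) (M : List (List ℤ)) (J : List ℕ) (hM : M.length = n)
    (hJ : J.length = n) :
    minorDet M J =
      (Matrix.of fun i j : Fin n => (M.getD i []).getD (J.getD j 0) 0).det := by
  induction n generalizing M J with
  | zero =>
    rw [List.length_eq_zero_iff.1 hM]
    simp [minorDet]
  | succ n ih =>
    match M, hM with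
    | r :: M, hM =>
      have h : minorDet (r :: M) J = (List.range (n + 1)).foldr (fun j a =>
          r.getD (J.getD j 0) 0 * minorDet M (J.eraseIdx j) - a) 0 := by
        rw [minorDet, hJ]
        congr 1
        funext j a
        dsimp only
        split_ifs with h
        · rw [h, zero_mul, zero_sub]
        · rfl
      rw [h, foldr_range_eq_sum (n + 1) fun j => r.getD (J.getD j 0) 0 *
        minorDet M (J.eraseIdx j), Matrix.det_succ_row_zero]
      refine Finset.sum_congr rfl fun j _ => ?_
      rw [ih M _ (by simpa using hM) (by
        rw [List.length_eraseIdx_of_lt (by rw [hJ]; exact j.2), hJ, Nat.add_sub_cancel]),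
        ← mul_assoc]
      congr 2
      ext i l
      simp only [Matrix.of_apply, Matrix.submatrix_apply, Fin.val_succ, List.getD_cons_succ]
      congr 1
      rw [List.getD_eq_getElem?_getD, List.getElem?_eraseIdx, List.getD_eq_getElem?_getD]
      by_cases hl : (l : ℕ) < j
      · rw [Fin.succAbove_of_castSucc_lt _ _ (Fin.lt_def.2 hl)]
        simp [hl]
      · rw [Fin.succAbove_of_le_castSucc _ _ (Fin.le_def.2 (not_lt.1 hl))]
        simp [hl]

/-! ### Linear functionals on `Λ^{S³}` -/

/-- A list of columns, indexed by the ranks of the triples; each column has a colour. -/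
abbrev Columns : Type := List (List ℤ × Bool)

/-- The entry in row `i` and column `j`. -/
def Columns.entry (C : Columns) (i j : ℕ) : ℤ := (C.getD j ([], false)).1.getD i 0

/-- The colour of column `j`. -/
def Columns.color (C : Columns) (j : ℕ) : Bool := (C.getD j ([], false)).2

/-- The `N × N` matrix whose entry in row `i` and column `j` is `C.entry i j` if `c i` is the colour
of column `j`, and zero otherwise. -/
def Columns.rows (C : Columns) (N : ℕ) (c : ℕ → Bool) : List (List ℤ) :=
  (List.range N).map fun i =>
    bif c i then C.map fun a => bif a.2 then a.1.getD i 0 else 0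
    else C.map fun a => bif a.2 then 0 else a.1.getD i 0

/-- The determinant of the matrix `C.rows N c`. -/
def Columns.value (C : Columns) (N : ℕ) (c : ℕ → Bool) : ℤ :=
  minorDet (C.rows N c) (List.range N)

/-- Some of the linear relations that the four rows belonging to a quadruple may satisfy. -/
def rowRelations : List (ℤ × ℤ × ℤ × ℤ) :=
  [(1, -1, 1, -1), (1, -1, 0, 0), (1, 0, -1, 0), (1, 0, 0, -1), (0, 1, -1, 0), (0, 1, 0, -1),
    (0, 0, 1, -1)]

/-- The four rows belonging to any quadruple satisfy one of the relations in `rowRelations`. -/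
def Columns.isDegenerate (C : Columns) (n : ℕ) : Bool :=
  (quadList n).all fun q => rowRelations.any fun w => (List.range (n.choose 3)).all fun j =>
    w.1 * C.entry (q.getD 0 0) j + w.2.1 * C.entry (q.getD 1 0) j +
      w.2.2.1 * C.entry (q.getD 2 0) j + w.2.2.2 * C.entry (q.getD 3 0) j == 0

theorem exists_eq_one_of_mem_rowRelations : ∀ w ∈ rowRelations,
    w.1 = 1 ∨ w.2.1 = 1 ∨ w.2.2.1 = 1 ∨ w.2.2.2 = 1 := by
  decide

/-- The relation is a left kernel vector; it is nonzero because the rows are distinct and one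
coefficient is `1`. -/
theorem det_eq_zero_of_four_rows {ι k : Type*} [Fintype ι] [DecidableEq ι] [Field k]
    (M : Matrix ι ι k) {a b c d : ι} (hab : a ≠ b) (hac : a ≠ c) (had : a ≠ d) (hbc : b ≠ c)
    (hbd : b ≠ d) (hcd : c ≠ d) (x y z w : k) (h1 : x = 1 ∨ y = 1 ∨ z = 1 ∨ w = 1)
    (h : ∀ j, x * M a j + y * M b j + z * M c j + w * M d j = 0) : M.det = 0 := by
  rw [← Matrix.exists_vecMul_eq_zero_iff]
  refine ⟨Pi.single a x + Pi.single b y + Pi.single c z + Pi.single d w, fun h0 => ?_, ?_⟩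
  · have ha := congrFun h0 a
    have hb := congrFun h0 b
    have hc := congrFun h0 c
    have hd := congrFun h0 d
    simp [hab, hac, had, hbc, hbd, hcd, hab.symm, hac.symm, had.symm, hbc.symm, hbd.symm,
      hcd.symm] at ha hb hc hd
    simp [ha, hb, hc, hd] at h1
  · simp only [Matrix.add_vecMul]
    funext j
    simpa [Matrix.single_vecMul] using h j

section
variable {k V : Type*} [Field k] [AddCommGroup V] [Module k V]

/-- The positions of the triples, when every position is attained. -/
noncomputable def rankEquiv {n : ℕ} (hn : ∀ i < n.choose 3, ∃ s : Triple n, s.rank = i) :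
    Fin (n.choose 3) ≃ Triple n :=
  (Equiv.ofBijective (fun s : Triple n => (⟨s.rank, s.rank_lt⟩ : Fin (n.choose 3)))
    ⟨fun s t h => Triple.rank_injective n (Fin.mk.inj_iff.1 h), fun i => by
      obtain ⟨s, hs⟩ := hn i i.2
      exact ⟨s, Fin.ext hs⟩⟩).symm

theorem rank_rankEquiv {n : ℕ} (hn : ∀ i < n.choose 3, ∃ s : Triple n, s.rank = i)
    (i : Fin (n.choose 3)) : (rankEquiv hn i).rank = i := by
  have := (rankEquiv hn).symm_apply_apply i
  exact congrArg Fin.val this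

/-- The determinant of the matrix with entries `C.entry i j` times the coordinate of the `i`-th
tensor factor determined by the colour of column `j`. -/
noncomputable def Columns.detMap (e : Module.Basis (Fin 2) k V) {n : ℕ}
    (hn : ∀ i < n.choose 3, ∃ s : Triple n, s.rank = i) (C : Columns) :
    MultilinearMap k (fun _ : Triple n => V) k :=
  ((Matrix.detRowAlternating (n := Fin (n.choose 3)) (R := k)).toMultilinearMap.compLinearMap
    fun i => LinearMap.pi fun j => (C.entry i j : k) • e.coord (if C.color j then 1 else 0)).domDomCongr
    (rankEquiv hn)

theorem Columns.detMap_apply (e : Module.Basis (Fin 2) k V) {n : ℕ}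
    (hn : ∀ i < n.choose 3, ∃ s : Triple n, s.rank = i) (C : Columns) (v : Triple n → V) :
    C.detMap e hn v = (Matrix.of fun i j : Fin (n.choose 3) => (C.entry i j : k) *
      e.coord (if C.color j then 1 else 0) (v (rankEquiv hn i))).det := rfl

/-- Equal vectors on a quadruple scale the four integer rows by the same coordinate in each column,
so the linear relation between the integer rows survives. -/
theorem Columns.detMap_eq_zero (e : Module.Basis (Fin 2) k V) {n : ℕ}
    (hn : ∀ i < n.choose 3, ∃ s : Triple n, s.rank = i) (C : Columns)
    (hC : C.isDegenerate n = true) (v : Triple n → V) (hv : ConstOnSomeQuadruple v) :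
    C.detMap e hn v = 0 := by
  obtain ⟨x, y, z, t, hxy, hyz, hzt, h1, h2, h3⟩ := hv
  simp only [Columns.isDegenerate, List.all_eq_true, List.any_eq_true, beq_iff_eq,
    List.mem_range] at hC
  obtain ⟨w, hw, hrel⟩ := hC _ (mem_quadList.2 ⟨x, y, z, t, hxy, hyz, hzt, t.2, rfl⟩)
  simp only [quadRanks, List.getD_cons_zero, List.getD_cons_succ] at hrel
  have hne := quadRanks_nodup (Fin.lt_def.1 hxy) (Fin.lt_def.1 hyz) (Fin.lt_def.1 hzt)
  simp only [quadRanks, List.nodup_cons, List.mem_cons, List.not_mem_nil, or_false, not_or] at hne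
  obtain ⟨⟨hab, hac, had⟩, ⟨hbc, hbd⟩, hcd, -⟩ := hne
  have hr : ∀ s : Triple n, rankEquiv hn ⟨s.rank, s.rank_lt⟩ = s := fun s =>
    Triple.rank_injective n (rank_rankEquiv hn _)
  rw [Columns.detMap_apply]
  let pos : Triple n → Fin (n.choose 3) := fun s => ⟨s.rank, s.rank_lt⟩
  have hpos : ∀ s t : Triple n, s.rank ≠ t.rank → pos s ≠ pos t := fun s t h h' =>
    h (congrArg Fin.val h')
  refine det_eq_zero_of_four_rows _
    (a := pos (Triple.of x y z hxy hyz)) (b := pos (Triple.of x y t hxy (hyz.trans hzt)))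
    (c := pos (Triple.of x z t (hxy.trans hyz) hzt)) (d := pos (Triple.of y z t hyz hzt))
    (hpos _ _ hab) (hpos _ _ hac) (hpos _ _ had) (hpos _ _ hbc) (hpos _ _ hbd) (hpos _ _ hcd)
    w.1 w.2.1 w.2.2.1 w.2.2.2 ?_ fun j => ?_
  · rcases exists_eq_one_of_mem_rowRelations w hw with h | h | h | h <;> simp [h]
  · have := congrArg (Int.cast (R := k)) (hrel j j.2)
    push_cast at this
    simp only [Matrix.of_apply, pos, hr, h1, h2, h3]
    have h' := congrArg (· * e.coord (if C.color j then 1 else 0) (v (Triple.of y z t hyz hzt))) this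
    simp only [zero_mul] at h'
    rw [← h']
    simp only [Triple.rank, Triple.of]
    ring

/-- The linear functional on `Λ^{S³}` defined by a list of columns. -/
noncomputable def Columns.functional (e : Module.Basis (Fin 2) k V) {n : ℕ}
    (hn : ∀ i < n.choose 3, ∃ s : Triple n, s.rank = i) (C : Columns)
    (hC : C.isDegenerate n = true) : LambdaS3 k V n →ₗ[k] k :=
  (ExtRelS3 k V n).liftQ (PiTensorProduct.lift (C.detMap e hn)) <| by
    rw [ExtRelS3, Submodule.span_le]
    rintro _ ⟨v, hv, rfl⟩
    simp [C.detMap_eq_zero e hn hC v hv]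

theorem Columns.functional_colorClass (e : Module.Basis (Fin 2) k V) {n : ℕ}
    (hn : ∀ i < n.choose 3, ∃ s : Triple n, s.rank = i) (C : Columns)
    (hC : C.isDegenerate n = true) (hlen : C.length = n.choose 3) (c : ℕ → Bool) :
    C.functional e hn hC (colorClass e n c) =
      (C.value (n.choose 3) c : k) := by
  simp only [Columns.functional, colorClass, Submodule.mkQ_apply, Submodule.liftQ_apply,
    PiTensorProduct.lift.tprod, Columns.detMap_apply]
  -- On basis vectors the matrix over `k` is the image of an integer matrix, so its determinant can
  -- be computed over the integers.
  rw [Columns.value, minorDet_eq_det (n.choose 3) _ _ (by simp [Columns.rows]) (by simp),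
    ← eq_intCast (Int.castRingHom k), RingHom.map_det]
  congr 1
  ext i j
  have hj : (j : ℕ) < C.length := by rw [hlen]; exact j.2
  have hrow : ((C.rows (n.choose 3) c).getD i []).getD ((List.range (n.choose 3)).getD j 0) 0 =
      bif C.color j == c i then C.entry i j else 0 := by
    simp only [Columns.rows, Columns.entry, Columns.color]
    rw [List.getD_eq_getElem _ _ hj, List.getD_eq_getElem (List.map _ _) [] (by simp),
      List.getD_eq_getElem (List.range _) 0 (by simp)]
    simp only [List.getElem_map, List.getElem_range]
    cases c i
    all_goals
      simp only [cond_true, cond_false]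
      rw [List.getD_eq_getElem (List.map _ _) 0 (by simpa using hj), List.getElem_map]
      cases C[(j : ℕ)].2 <;> rfl
  simp only [Matrix.of_apply, RingHom.mapMatrix_apply, Matrix.map_apply, eq_intCast, hrow,
    rank_rankEquiv]
  cases C.color j <;> cases c i <;> simp

/-- A list of colourings and of functionals, such that each functional does not vanish on its own
colouring and vanishes on the later ones. -/
def isTriangular (n : ℕ) : List (ℕ × Columns) → Bool
  | [] => true
  | a :: D => a.2.isDegenerate n && a.2.length == n.choose 3 &&
      (let x := a.2.value (n.choose 3) a.1.testBit
       x == 1 || x == -1) &&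
      (D.all fun b => a.2.value (n.choose 3) b.1.testBit == 0) &&
      isTriangular n D

/-- The functional of the head kills the span of the later classes but takes the value `1` or `-1`
on its own, which stays nonzero in `k`. -/
theorem linearIndependent_of_isTriangular (e : Module.Basis (Fin 2) k V) {n : ℕ}
    (hn : ∀ i < n.choose 3, ∃ s : Triple n, s.rank = i) (D : List (ℕ × Columns))
    (hD : isTriangular n D = true) :
    LinearIndependent k fun i : Fin D.length => colorClass e n (D[i].1).testBit := by
  induction D with
  | nil =>
    have : IsEmpty (Fin ([] : List (ℕ × Columns)).length) := Fin.isEmpty'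
    exact linearIndependent_empty_type
  | cons a D ih =>
    simp only [isTriangular, Bool.and_eq_true, beq_iff_eq, Bool.or_eq_true, List.all_eq_true] at hD
    obtain ⟨⟨⟨⟨hdeg, hlen⟩, hone⟩, hzero⟩, hD⟩ := hD
    rw [linearIndependent_finSucc]
    refine ⟨ih hD, fun hmem => ?_⟩
    have hker : Submodule.span k (Set.range (Fin.tail fun i : Fin (D.length + 1) =>
        colorClass e n ((a :: D)[i].1).testBit)) ≤
        LinearMap.ker (a.2.functional e hn hdeg) := by
      rw [Submodule.span_le]
      rintro _ ⟨i, rfl⟩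
      have := hzero D[i] (List.getElem_mem _)
      change a.2.functional e hn hdeg (colorClass e n (D[i].1).testBit) = 0
      rw [a.2.functional_colorClass e hn hdeg hlen, this, Int.cast_zero]
    have h0 : a.2.functional e hn hdeg (colorClass e n a.1.testBit) = 0 := hker hmem
    rw [a.2.functional_colorClass e hn hdeg hlen] at h0
    rcases hone with h | h <;> simp [h] at h0

end

/-! ### Minors of the boundary matrix and pairings -/

/-- The matrix of the simplicial boundary of the full simplex on `{0, …, n - 1}` in dimension two;
one list for every edge `a < b`, with one entry for every triple, both in colexicographic order. -/
def boundaryColumns (n : ℕ) : List (List ℤ) :=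
  (List.range n).flatMap fun b => (List.range b).map fun a =>
    (List.range n).flatMap fun l => (List.range l).flatMap fun j => (List.range j).map fun i =>
      (if a == j && b == l then 1 else 0) - (if a == i && b == l then 1 else 0) +
        (if a == i && b == j then 1 else 0)

/-- The columns of the boundary matrix for the edges in `E₀` and `E₁`, of colours `false` and
`true`. -/
def edgeColumns (n : ℕ) (E₀ E₁ : List ℕ) : Columns :=
  E₀.map (fun i => ((boundaryColumns n).getD i [], false)) ++
    E₁.map fun i => ((boundaryColumns n).getD i [], true)

/-- For every pair of triples of `{0, …, 4}`, its indicator function, once in each colour. The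
functional defined by these columns is a product of `2 × 2` determinants. -/
def pairColumns (P : List (ℕ × ℕ)) : Columns :=
  P.flatMap fun p =>
    [((List.range 10).map fun t => if t == p.1 || t == p.2 then 1 else 0, false),
      ((List.range 10).map fun t => if t == p.1 || t == p.2 then 1 else 0, true)]

/-! ### Explicit separating functionals -/

/-- The standard colourings of the triples of `{0, …, 3}`, with edges selecting minors of the boundary
matrix that separate them. -/
def minors4 : List (ℕ × List ℕ × List ℕ) :=
  [(1, [0, 1, 2], [2]), (2, [0, 1, 2], [4]), (4, [0, 1, 2], [5]), (9, [0, 1], [1, 2]),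
   (10, [0, 1], [2, 3]), (5, [0, 2], [1, 2]), (6, [0, 2], [1, 4]), (3, [1, 4], [2, 3]),
   (13, [0], [0, 1, 2]), (11, [1], [0, 1, 2]), (7, [2], [0, 1, 2])]

/-- Colourings of the triples of `{0, …, 4}`, with edges selecting minors of the boundary matrix. -/
def minors5a : List (ℕ × List ℕ × List ℕ) :=
  [(597, [1, 2, 4, 6, 7], [1, 3, 7, 8, 9]), (541, [1, 2, 4, 6, 7], [2, 4, 5, 7, 9]),
   (555, [1, 2, 4, 6, 7], [1, 4, 5, 8, 9]), (569, [1, 2, 4, 6, 7], [1, 4, 7, 8, 9]),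
   (570, [0, 3, 4, 6, 7], [4, 5, 7, 8, 9]), (341, [1, 3, 5, 6, 8], [1, 3, 6, 8, 9]),
   (285, [2, 3, 5, 6, 8], [2, 4, 5, 7, 9]), (299, [2, 3, 5, 6, 8], [2, 4, 5, 8, 9]),
   (313, [0, 2, 5, 6, 8], [1, 4, 7, 8, 9]), (314, [0, 3, 5, 6, 8], [4, 5, 7, 8, 9]),
   (203, [1, 4, 5, 6, 9], [1, 4, 5, 8, 9]), (217, [0, 4, 5, 6, 9], [1, 4, 7, 8, 9]),
   (218, [0, 3, 4, 6, 9], [4, 5, 7, 8, 9]), (227, [2, 4, 5, 7, 9], [1, 3, 7, 8, 9]),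
   (186, [0, 3, 4, 7, 8], [4, 5, 7, 8, 9]), (214, [2, 4, 7, 8, 9], [4, 5, 6, 8, 9])]

/-- Colourings of the triples of `{0, …, 4}`, with pairings of the triples. -/
def pairings5 : List (ℕ × List (ℕ × ℕ)) :=
  [(279, [(0, 3), (4, 6), (1, 7), (2, 5), (8, 9)]), (295, [(0, 3), (5, 6), (1, 4), (2, 7),
   (8, 9)]), (199, [(1, 3), (0, 4), (7, 8), (2, 5), (6, 9)]), (391, [(2, 3), (0, 6), (1, 4),
   (5, 7), (8, 9)]), (103, [(2, 3), (0, 4), (1, 8), (5, 7), (6, 9)]), (213, [(2, 3), (0, 5),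
   (1, 4), (7, 9), (6, 8)]), (87, [(0, 3), (4, 5), (1, 7), (2, 9), (6, 8)]), (211, [(0, 3),
   (4, 5), (1, 8), (2, 7), (6, 9)]), (93, [(1, 3), (0, 5), (4, 7), (2, 9), (6, 8)])]

/-- Colourings of the triples of `{0, …, 4}`, with edges selecting minors of the boundary matrix. -/
def minors5b : List (ℕ × List ℕ × List ℕ) :=
  [(157, [2, 4, 6, 7, 9], [2, 4, 5, 7, 9]), (185, [0, 2, 5, 7, 9], [2, 5, 7, 8, 9]),
   (171, [1, 2, 6, 8, 9], [1, 4, 5, 8, 9]), (61, [0, 2, 7, 8, 9], [1, 4, 5, 7, 8]),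
   (173, [2, 4, 7, 8, 9], [2, 4, 5, 8, 9]), (59, [2, 5, 6, 8, 9], [1, 3, 5, 7, 8]),
   (155, [2, 5, 6, 8, 9], [1, 3, 5, 7, 9]), (277, [2, 4, 5, 7, 8, 9], [1, 3, 6, 9]),
   (85, [2, 4, 5, 7, 8, 9], [0, 1, 7, 8]), (195, [2, 4, 5, 6, 8, 9], [1, 3, 8, 9]),
   (43, [2, 4, 5, 6, 8, 9], [1, 4, 5, 8]), (169, [2, 3, 5, 7, 8, 9], [2, 5, 8, 9]),
   (57, [2, 4, 5, 7, 8, 9], [1, 4, 7, 8]), (139, [2, 4, 5, 6, 8, 9], [2, 4, 5, 9]),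
   (154, [0, 4, 5, 6, 7, 9], [4, 5, 7, 9]), (170, [2, 4, 5, 6, 8, 9], [4, 5, 8, 9]),
   (209, [2, 3, 5, 6, 7, 9], [2, 7, 8, 9]), (210, [0, 4, 5, 7, 8, 9], [4, 6, 8, 9]),
   (212, [2, 3, 5, 6, 7, 9], [5, 7, 8, 9]), (58, [0, 3, 4, 6, 7, 9], [4, 5, 7, 8]),
   (29, [0, 2, 5, 6, 7, 9], [2, 4, 5, 7]), (153, [2, 3, 5, 7, 8, 9], [2, 5, 6, 9]),
   (797, [0, 1, 2, 6], [0, 4, 5, 7, 8, 9]), (605, [0, 1, 4, 6], [1, 4, 5, 7, 8, 9]),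
   (349, [0, 1, 5, 6], [2, 4, 5, 7, 8, 9]), (669, [1, 2, 4, 7], [0, 4, 5, 7, 8, 9]),
   (427, [0, 2, 5, 8], [1, 4, 5, 7, 8, 9]), (573, [0, 2, 3, 7], [0, 4, 5, 7, 8, 9]),
   (235, [0, 4, 5, 9], [1, 4, 5, 6, 8, 9]), (317, [0, 2, 5, 6], [0, 4, 5, 6, 8, 9]),
   (221, [0, 4, 5, 6], [0, 4, 5, 6, 8, 9]), (189, [0, 2, 5, 7], [0, 4, 5, 6, 8, 9]),
   (315, [2, 3, 5, 8], [1, 3, 5, 6, 8, 9]), (571, [1, 2, 6, 7], [0, 3, 5, 6, 8, 9]),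
   (215, [2, 6, 7, 9], [0, 4, 5, 6, 8, 9]), (219, [1, 4, 6, 9], [1, 3, 5, 7, 8, 9]),
   (187, [2, 3, 4, 9], [2, 3, 5, 7, 8, 9])]

/-- The standard colourings of the triples of `{0, …, 4}`, with functionals separating them. -/
def triangular5 : List (ℕ × Columns) :=
  minors5a.map (fun t => (t.1, edgeColumns 5 t.2.1 t.2.2)) ++
    pairings5.map (fun t => (t.1, pairColumns t.2)) ++
    minors5b.map (fun t => (t.1, edgeColumns 5 t.2.1 t.2.2))

/-- The standard colourings of the triples of `{0, …, 3}`, with functionals separating them. -/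
def triangular4 : List (ℕ × Columns) :=
  minors4.map fun t => (t.1, edgeColumns 4 t.2.1 t.2.2)

/-- A colouring of the triples of `{0, …, 5}`, with a maximal minor of the boundary matrix that does
not vanish on it. -/
def triangular6 : List (ℕ × Columns) :=
  [(79645, edgeColumns 6 [0, 2, 3, 5, 6, 7, 11, 12, 13, 14] [1, 3, 5, 6, 8, 9, 10, 12, 13, 14])]

theorem isTriangular_triangular4 : isTriangular 4 triangular4 = true := by
  decide +kernel

theorem isTriangular_triangular5 : isTriangular 5 triangular5 = true := by
  decide +kernel

theorem isTriangular_triangular6 : isTriangular 6 triangular6 = true := by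
  decide +kernel

/-! ### Dimensions -/

theorem exists_rank_eq_of_lt : ∀ n ∈ [0, 1, 2, 3, 4, 5, 6], ∀ i < n.choose 3,
    ∃ s : Triple n, s.rank = i := by
  have h : ∀ n ∈ [0, 1, 2, 3, 4, 5, 6], ∀ i ∈ List.range (n.choose 3),
      ∃ x ∈ List.finRange n, ∃ y ∈ List.finRange n, ∃ z ∈ List.finRange n,
        (x < y ∧ y < z) ∧ tripleRank x y z = i := by
    decide +kernel
  intro n hn i hi
  obtain ⟨x, -, y, -, z, -, hxyz, h⟩ := h n hn i (List.mem_range.2 hi)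
  exact ⟨⟨(x, y, z), hxyz⟩, h⟩

section
variable {k V : Type*} [Field k] [AddCommGroup V] [Module k V]

/-- The meeting point of the two bounds: triangular functionals give independence, reductions give
spanning, so the listed classes form a basis. -/
theorem rank_eq_length_of_isTriangular (e : Module.Basis (Fin 2) k V) {n : ℕ}
    (hn : n ∈ [0, 1, 2, 3, 4, 5, 6]) (D : List (ℕ × Columns)) (hD : isTriangular n D = true)
    (hspan : ∀ m < 2 ^ n.choose 3, colorClass e n m.testBit ∈
      Submodule.span k ((fun m : ℕ => colorClass e n m.testBit) '' {m | m ∈ D.map Prod.fst})) :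
    Module.rank k (LambdaS3 k V n) = D.length := by
  have hli := linearIndependent_of_isTriangular e (exists_rank_eq_of_lt n hn) D hD
  have htop := span_colorClass_of_forall_mem hspan
  have hrange : Set.range (fun i : Fin D.length => colorClass e n (D[i].1).testBit) =
      (fun m : ℕ => colorClass e n m.testBit) '' {m | m ∈ D.map Prod.fst} := by
    ext x
    simp only [Set.mem_range, Set.mem_image, Set.mem_ofPred_eq, List.mem_map]
    constructor
    · rintro ⟨i, rfl⟩
      exact ⟨_, ⟨_, List.getElem_mem _, rfl⟩, rfl⟩
    · rintro ⟨_, ⟨a, ha, rfl⟩, rfl⟩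
      obtain ⟨i, hi, rfl⟩ := List.mem_iff_getElem.1 ha
      exact ⟨⟨i, hi⟩, rfl⟩
  rw [rank_eq_card_basis (Module.Basis.mk hli (by rw [hrange, htop])), Fintype.card_fin]

theorem rank_lambdaS3_of_le_two (e : Module.Basis (Fin 2) k V) {n : ℕ} (hn : n ∈ [0, 1, 2]) :
    Module.rank k (LambdaS3 k V n) = 1 := by
  -- There are no triples, and the functional is the empty determinant, equal to `1`.
  have hD : ∀ n ∈ [0, 1, 2], isTriangular n [(0, [])] = true := by decide +kernel
  have h0 : n.choose 3 = 0 := by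
    have : ∀ n ∈ [0, 1, 2], n.choose 3 = 0 := by decide
    exact this n hn
  have hn' : n ∈ [0, 1, 2, 3, 4, 5, 6] := by
    simp only [List.mem_cons, List.not_mem_nil, or_false] at hn ⊢
    omega
  have := rank_eq_length_of_isTriangular e hn' [(0, [])] (hD n hn) (fun m hm => by
    rw [h0, pow_zero, Nat.lt_one_iff] at hm
    subst hm
    exact Submodule.subset_span ⟨0, by simp, rfl⟩)
  simpa using this

theorem rank_lambdaS3_three (e : Module.Basis (Fin 2) k V) :
    Module.rank k (LambdaS3 k V 3) = 2 := by
  have := rank_eq_length_of_isTriangular e (n := 3) (by simp)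
    -- With a single triple the `1 × 1` determinants are the two coordinate functionals.
    [(0, [([1], false)]), (1, [([1], true)])] (by decide +kernel) (fun m hm => by
      have hm : m < 2 := hm
      exact Submodule.subset_span ⟨m, by simp; omega, rfl⟩)
  simpa using this

theorem rank_lambdaS3_four [Infinite k] (e : Module.Basis (Fin 2) k V) :
    Module.rank k (LambdaS3 k V 4) = 11 := by
  have hS : ∀ m ∈ standardCodes4, m ∈ triangular4.map Prod.fst := by decide +kernel
  have hlen : triangular4.length = 11 := by decide +kernel
  have := rank_eq_length_of_isTriangular e (n := 4) (by simp) triangular4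
    isTriangular_triangular4 (fun m hm => Submodule.span_mono (Set.image_mono hS)
      ((quadRelations_colorClass e 4).mem_span_standardCodes4 m hm))
  simpa [hlen] using this

theorem mem_triangular5_of_mem_standardCodes5 :
    ∀ m ∈ standardCodes5, m ∈ triangular5.map Prod.fst := by
  decide +kernel

theorem rank_lambdaS3_five [Infinite k] (e : Module.Basis (Fin 2) k V) :
    Module.rank k (LambdaS3 k V 5) = 62 := by
  have hlen : triangular5.length = 62 := by decide +kernel
  have := rank_eq_length_of_isTriangular e (n := 5) (by simp) triangular5
    isTriangular_triangular5 (fun m hm =>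
      Submodule.span_mono (Set.image_mono mem_triangular5_of_mem_standardCodes5)
        ((quadRelations_colorClass e 5).mem_span_standardCodes5 m hm))
  simpa [hlen] using this

theorem rank_lambdaS3_six [Infinite k] (e : Module.Basis (Fin 2) k V) :
    Module.rank k (LambdaS3 k V 6) = 1 := by
  have := rank_eq_length_of_isTriangular e (n := 6) (by simp) triangular6
    isTriangular_triangular6 (fun m hm => by
      simpa [triangular6] using (quadRelations_colorClass e 6).mem_span_six m hm)
  simpa [triangular6] using this

theorem rank_lambdaS3_of_seven_le [Infinite k] (e : Module.Basis (Fin 2) k V) {n : ℕ}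
    (hn : 7 ≤ n) : Module.rank k (LambdaS3 k V n) = 0 := by
  have htop : (⊥ : Submodule k (LambdaS3 k V n)) = ⊤ := by
    rw [← span_colorClass e n, eq_comm, Submodule.span_eq_bot]
    rintro _ ⟨m, -, rfl⟩
    exact (quadRelations_colorClass e n).eq_zero hn _
  rw [← rank_top, ← htop, rank_bot]

/-! ### The weight decomposition for `n = 5` -/

theorem trueCount_eq_card (c : ℕ → Bool) :
    trueCount c = (Finset.univ.filter fun s : Triple 5 => c s.rank = true).card := by
  rw [trueCount, ← Finset.card_map ⟨Triple.rank, Triple.rank_injective 5⟩]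
  congr 1
  ext p
  simp only [Finset.mem_filter, Finset.mem_range, Finset.mem_map, Finset.mem_univ, true_and,
    Function.Embedding.coeFn_mk]
  constructor
  · rintro ⟨hp, hc⟩
    obtain ⟨s, rfl⟩ := exists_rank_eq_of_lt 5 (by simp) p hp
    exact ⟨s, hc, rfl⟩
  · rintro ⟨s, hc, rfl⟩
    exact ⟨s.rank_lt, hc⟩

theorem card_triple_five : Fintype.card (Triple 5) = 10 := by
  have := Fintype.card_congr (rankEquiv (exists_rank_eq_of_lt 5 (by simp)))
  rw [← this, Fintype.card_fin]
  rfl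

/-- Reduction within a fixed weight shows that each weight piece is spanned by the basis classes of
that weight. -/
theorem weightPieceS3_five (e : Module.Basis (Fin 2) k V) [Infinite k] {p q : ℕ}
    (hpq : p + q = 10) :
    weightPieceS3 e 5 p q = Submodule.span k
      ((fun i : Fin triangular5.length => colorClass e 5 (triangular5[i].1).testBit) ''
        {i | trueCount (triangular5[i].1).testBit = q}) := by
  refine le_antisymm (Submodule.span_le.2 ?_) (Submodule.span_le.2 ?_)
  · rintro _ ⟨d, -, hq, rfl⟩
    obtain ⟨m, hm, hd⟩ := exists_testBit_rank d
    have hcount : trueCount m.testBit = q := by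
      rw [trueCount_eq_card, ← hq]
      congr 1
      refine Finset.filter_congr fun s _ => ?_
      rw [← hd s]
      cases m.testBit s.rank <;> simp
    have hmem := (quadRelations_colorClass e 5).mem_span_standardCodes5_trueCount (k := k) m hm
    have hclass : (ExtRelS3 k V 5).mkQ (PiTensorProduct.tprod k fun s => e (d s)) =
        colorClass e 5 m.testBit := by
      simp only [colorClass, hd]
    rw [hclass]
    refine Submodule.span_mono ?_ hmem
    rintro _ ⟨x, ⟨hx, hxq⟩, rfl⟩
    have hx' := mem_triangular5_of_mem_standardCodes5 x hx
    obtain ⟨a, ha, rfl⟩ := List.mem_map.1 hx'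
    obtain ⟨i, hi, rfl⟩ := List.mem_iff_getElem.1 ha
    exact ⟨⟨i, hi⟩, hxq.trans hcount, rfl⟩
  · rintro _ ⟨i, hi, rfl⟩
    have h1 : (Finset.univ.filter fun s : Triple 5 =>
        (if (triangular5[i].1).testBit s.rank then (1 : Fin 2) else 0) = 1).card = q := by
      rw [← show _ = q from hi, trueCount_eq_card]
      congr 1
      refine Finset.filter_congr fun s _ => ?_
      cases (triangular5[i].1).testBit s.rank <;> simp
    refine Submodule.subset_span ⟨fun s => if (triangular5[i].1).testBit s.rank then 1 else 0,
      ?_, h1, rfl⟩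
    have h2 := Finset.card_filter_add_card_filter_not (s := (Finset.univ : Finset (Triple 5)))
      fun s => (if (triangular5[i].1).testBit s.rank then (1 : Fin 2) else 0) = 1
    rw [h1, Finset.card_univ, card_triple_five] at h2
    have h3 : (Finset.univ.filter fun s : Triple 5 =>
        (if (triangular5[i].1).testBit s.rank then (1 : Fin 2) else 0) = 0) =
        Finset.univ.filter fun s : Triple 5 =>
        ¬ (if (triangular5[i].1).testBit s.rank then (1 : Fin 2) else 0) = 1 := by
      refine Finset.filter_congr fun s _ => ?_
      cases (triangular5[i].1).testBit s.rank <;> simp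
    rw [h3]
    omega

/-- A partition of a basis gives a decomposition as an internal direct sum. -/
theorem isInternal_span_image_preimage {R M ι κ : Type*} [Ring R] [AddCommGroup M] [Module R M]
    [DecidableEq κ] {v : ι → M} (hli : LinearIndependent R v)
    (hspan : Submodule.span R (Set.range v) = ⊤) (w : ι → κ) :
    DirectSum.IsInternal fun j : κ => Submodule.span R (v '' (w ⁻¹' {j})) := by
  refine DirectSum.isInternal_submodule_of_iSupIndep_of_iSup_eq_top ?_ ?_
  · intro j
    refine (hli.disjoint_span_image (disjoint_compl_right (a := w ⁻¹' {j}))).mono_right ?_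
    refine iSup₂_le fun i hi => Submodule.span_mono (Set.image_mono ?_)
    intro x hx hx'
    exact hi (hx.symm.trans hx')
  · rw [eq_top_iff, ← hspan, Submodule.span_le]
    rintro _ ⟨i, rfl⟩
    exact Submodule.mem_iSup_of_mem (w i) (Submodule.subset_span ⟨i, rfl, rfl⟩)

theorem rank_span_image {R M ι : Type*} [Ring R] [StrongRankCondition R] [AddCommGroup M]
    [Module R M] [Fintype ι] {v : ι → M} (hli : LinearIndependent R v) (p : ι → Prop)
    [DecidablePred p] :
    Module.rank R (Submodule.span R (v '' {i | p i})) = (Finset.univ.filter p).card := by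
  have hr : Set.range (v ∘ ((↑) : {i // p i} → ι)) = v '' {i | p i} := by
    rw [Set.range_comp, Subtype.range_coe_subtype]
  rw [← hr, rank_eq_card_basis (Module.Basis.span (hli.comp _ Subtype.val_injective)),
    Fintype.card_subtype]

theorem trueCount_triangular5 : ∀ i : Fin triangular5.length,
    trueCount (triangular5[i].1).testBit = 4 ∨ trueCount (triangular5[i].1).testBit = 5 ∨
      trueCount (triangular5[i].1).testBit = 6 := by
  decide +kernel

theorem card_trueCount_triangular5 :
    (Finset.univ.filter fun i : Fin triangular5.length =>
      trueCount (triangular5[i].1).testBit = 4).card = 15 ∧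
    (Finset.univ.filter fun i : Fin triangular5.length =>
      trueCount (triangular5[i].1).testBit = 5).card = 32 ∧
    (Finset.univ.filter fun i : Fin triangular5.length =>
      trueCount (triangular5[i].1).testBit = 6).card = 15 := by
  decide +kernel

theorem isInternal_weightPieceS3_five [Infinite k] (e : Module.Basis (Fin 2) k V) :
    DirectSum.IsInternal
      ![weightPieceS3 e 5 6 4, weightPieceS3 e 5 5 5, weightPieceS3 e 5 4 6] := by
  have hli := linearIndependent_of_isTriangular e (exists_rank_eq_of_lt 5 (by simp)) triangular5
    isTriangular_triangular5
  have hspan : Submodule.span k (Set.range fun i : Fin triangular5.length =>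
      colorClass e 5 (triangular5[i].1).testBit) = ⊤ := by
    rw [eq_top_iff, ← span_colorClass_of_forall_mem (e := e) (n := 5)
      (quadRelations_colorClass e 5).mem_span_standardCodes5]
    refine Submodule.span_mono ?_
    rintro _ ⟨x, hx, rfl⟩
    obtain ⟨a, ha, rfl⟩ := List.mem_map.1 (mem_triangular5_of_mem_standardCodes5 x hx)
    obtain ⟨i, hi, rfl⟩ := List.mem_iff_getElem.1 ha
    exact ⟨⟨i, hi⟩, rfl⟩
  let w : Fin triangular5.length → Fin 3 := fun i =>
    if trueCount (triangular5[i].1).testBit = 4 then 0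
    else if trueCount (triangular5[i].1).testBit = 5 then 1 else 2
  -- The summands are listed by increasing number of entries `e 1`, namely `4`, `5`, `6`.
  have hw : ∀ (j : Fin 3) (q : ℕ), q = j + 4 →
      w ⁻¹' {j} = {i | trueCount (triangular5[i].1).testBit = q} := by
    intro j q hq
    ext i
    simp only [Set.mem_preimage, Set.mem_singleton_iff, Set.mem_ofPred_eq, w]
    rcases trueCount_triangular5 i with h | h | h <;> rw [h] <;> fin_cases j <;>
      simp at hq ⊢ <;> omega
  have key := isInternal_span_image_preimage hli hspan w
  have heq : ![weightPieceS3 e 5 6 4, weightPieceS3 e 5 5 5, weightPieceS3 e 5 4 6] =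
      fun j => Submodule.span k ((fun i : Fin triangular5.length =>
        colorClass e 5 (triangular5[i].1).testBit) '' (w ⁻¹' {j})) := by
    funext j
    fin_cases j
    · dsimp only; rw [hw _ 4 rfl]; exact weightPieceS3_five e rfl
    · dsimp only; rw [hw _ 5 rfl]; exact weightPieceS3_five e rfl
    · dsimp only; rw [hw _ 6 rfl]; exact weightPieceS3_five e rfl
  rw [heq]
  exact key

theorem rank_weightPieceS3_five [Infinite k] (e : Module.Basis (Fin 2) k V) {p q : ℕ}
    (hpq : p + q = 10) :
    Module.rank k (weightPieceS3 e 5 p q) = (Finset.univ.filter fun i : Fin triangular5.length =>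
      trueCount (triangular5[i].1).testBit = q).card := by
  rw [weightPieceS3_five e hpq]
  exact rank_span_image (linearIndependent_of_isTriangular e (exists_rank_eq_of_lt 5 (by simp))
    triangular5 isTriangular_triangular5) _

end

theorem proposition4p11 {k : Type*} [Field k] [Infinite k]
    (hchar2 : ringChar k ≠ 2) (hchar3 : ringChar k ≠ 3)
    {V : Type*} [AddCommGroup V] [Module k V] (hV : Module.rank k V = 2) :
    Module.rank k (LambdaS3 k V 0) = 1 ∧
    Module.rank k (LambdaS3 k V 1) = 1 ∧
    Module.rank k (LambdaS3 k V 2) = 1 ∧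
    Module.rank k (LambdaS3 k V 3) = 2 ∧
    Module.rank k (LambdaS3 k V 4) = 11 ∧
    Module.rank k (LambdaS3 k V 5) = 62 ∧
    (∀ e : Module.Basis (Fin 2) k V,
      DirectSum.IsInternal
        ![weightPieceS3 e 5 6 4, weightPieceS3 e 5 5 5, weightPieceS3 e 5 4 6] ∧
      Module.rank k (weightPieceS3 e 5 6 4) = 15 ∧
      Module.rank k (weightPieceS3 e 5 5 5) = 32 ∧
      Module.rank k (weightPieceS3 e 5 4 6) = 15) ∧
    Module.rank k (LambdaS3 k V 6) = 1 ∧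
    (∀ n : ℕ, 7 ≤ n → Module.rank k (LambdaS3 k V n) = 0) := by

  have e : Module.Basis (Fin 2) k V := by
    have hfin : Module.finrank k V = 2 := by
      rw [Module.finrank, hV]; simp
    have : Module.Finite k V := Module.finite_of_finrank_eq_succ hfin
    exact Module.finBasisOfFinrankEq k V hfin
  refine ⟨rank_lambdaS3_of_le_two e (by simp), rank_lambdaS3_of_le_two e (by simp),
    rank_lambdaS3_of_le_two e (by simp), rank_lambdaS3_three e, rank_lambdaS3_four e,
    rank_lambdaS3_five e, fun e => ⟨isInternal_weightPieceS3_five e, ?_, ?_, ?_⟩,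
    rank_lambdaS3_six e, fun n hn => rank_lambdaS3_of_seven_le e hn⟩
  · rw [rank_weightPieceS3_five e rfl, card_trueCount_triangular5.1]; rfl
  · rw [rank_weightPieceS3_five e rfl, card_trueCount_triangular5.2.1]; rfl
  · rw [rank_weightPieceS3_five e rfl, card_trueCount_triangular5.2.2]; rfl
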